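/- Let $N\ge 0$ be an integer and let $k_1,k_2,k_3\in\mathbb R$ satisfy $k_3>0$, $k_2>-1/2$ and $k_1+k_2>-1/2$. Let $A_N=\{x\in\mathbb R^N:\ -1\le x_1\le\dots\le x_N\le 1\}$, let $$w(x)=\prod_{i=1}^N(1-x_i)^{k_1+k_2-1/2}(1+x_i)^{k_2-1/2}\prod_{1\le i<j\le N}|x_i-x_j|^{2k_3},$$ and put $$\alpha=\frac{1+2k_1+2k_2}{2k_3}-1,\qquad \beta=\frac{1+2k_2}{2k_3}-1 .$$ Let $P_N^{(\alpha,\beta)}(x)=\sum_{k=0}^N\binom Nk\frac{(N+\alpha+\beta+1)_k(\alpha+k+1)_{N-k}}{N!}\bigl(\frac{x-1}2\bigr)^k$ be the classical Jacobi polynomial, $l_N^{(\alpha,\beta)}$ its leading coefficient, $(a)_k=a(a+1)\cdots(a+k-1)$, and let $e_n$ denote the $n$-th elementary symmetric polynomial in $N$ variables. Then $\alpha,\beta>-1$, $w$ is integrable over $A_N$ with strictly positive integral, and the following hold. (1) Let $X$ be an $A_N$-valued random variable with Lebesgue density $c\,w$ on $A_N$, where $c$ is the normalizing constant. Then $$\mathbb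 E\Bigl(\prod_{i=1}^N(y-X_i)\Bigr)=\frac1{l_N^{(\alpha,\beta)}}P_N^{(\alpha,\beta)}(y)\qquad\text{for all }y\in\mathbb R,$$ and, for $n=0,1,\dots,N$, $$\mathbb E\bigl(e_n(X)\bigr)=\frac{2^N}{\binom{2N+\alpha+\beta}{N}}\sum_{l=N-n}^N(-1)^{N-l}\binom Nl\binom l{N-n}\frac{(N+\alpha+\beta+1)_l\,(\alpha+l+1)_{N-l}}{N!\,2^l}$$ (all expectations being finite). (2) (Aomoto's Selberg integral.) With $a=k_1+k_2+\frac12$, $b=k_2+\frac12$ and $\Phi(u)=\prod_{i=1}^N u_i^{a-1}(1-u_i)^{b-1}\prod_{i<j}|u_i-u_j|^{2k_3}$, for $n=0,1,\dots,N$, $$\frac{\int_{[0,1]^N}e_n(u)\,\Phi(u)\,du}{\int_{[0,1]^N}\Phi(u)\,du}=\binom Nn\prod_{j=1}^n\frac{a+(N-j)k_3}{a+b+(2N-j-1)k_3}.$$ -/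

import Mathlib

open MeasureTheory

namespace JacobiEnsemble

/-- The alcove `{x ∈ ℝ^N : -1 ≤ x₁ ≤ ⋯ ≤ x_N ≤ 1}`. -/
def alcove (N : ℕ) : Set (Fin N → ℝ) :=
  {x | (∀ i, x i ∈ Set.Icc (-1 : ℝ) 1) ∧ Monotone x}

/-- The interaction factor `∏_{i<j} |x_i - x_j|^s`. -/
noncomputable def interaction (N : ℕ) (s : ℝ) (x : Fin N → ℝ) : ℝ :=
  ∏ i : Fin N, ∏ j ∈ Finset.Ioi i, |x i - x j| ^ s

/-- The (unnormalized) weight of the Jacobi ensemble on the alcove,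
`∏_i (1-x_i)^{k₁+k₂-1/2} (1+x_i)^{k₂-1/2} ∏_{i<j} |x_i-x_j|^{2k₃}`. -/
noncomputable def weight (N : ℕ) (k₁ k₂ k₃ : ℝ) (x : Fin N → ℝ) : ℝ :=
  (∏ i : Fin N, (1 - x i) ^ (k₁ + k₂ - 1 / 2) * (1 + x i) ^ (k₂ - 1 / 2)) *
    interaction N (2 * k₃) x

/-- The elementary symmetric polynomial `e_n` in `N` variables, as a function on `ℝ^N`. -/
noncomputable def e (N n : ℕ) (x : Fin N → ℝ) : ℝ :=
  MvPolynomial.eval x (MvPolynomial.esymm (Fin N) ℝ n)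

/-- The rising factorial (Pochhammer symbol) `(a)_n = a (a+1) ⋯ (a+n-1)`. -/
noncomputable def rising (a : ℝ) (n : ℕ) : ℝ := (ascPochhammer ℝ n).eval a

/-- The classical Jacobi polynomial `P_n^{(α,β)}`,
`∑_{k=0}^n binom(n,k) (n+α+β+1)_k (α+k+1)_{n-k} / n! ((x-1)/2)^k`. -/
noncomputable def jacobiP (n : ℕ) (α β : ℝ) : Polynomial ℝ :=
  ∑ k ∈ Finset.range (n + 1),
    Polynomial.C ((n.choose k : ℝ) * (rising (n + α + β + 1) k * rising (α + k + 1) (n - k)) /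
        (n.factorial : ℝ)) *
      (Polynomial.C (1 / 2) * (Polynomial.X - 1)) ^ k

/-- The integrand of Selberg's integral on the cube `[0,1]^N`,
`∏_i u_i^{a-1} (1-u_i)^{b-1} ∏_{i<j} |u_i-u_j|^{2γ}`. -/
noncomputable def selbergWeight (N : ℕ) (a b γ : ℝ) (u : Fin N → ℝ) : ℝ :=
  (∏ i : Fin N, u i ^ (a - 1) * (1 - u i) ^ (b - 1)) * interaction N (2 * γ) u

end JacobiEnsemble

/-! The core is Aomoto's argument on the cube. For `S ⊆ Fin N`, the moment of `∏ i ∈ S, x i` against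
the Selberg density depends only on `S.card`, by symmetry. Integrate the derivative in `x 0` of `x 0
* (1 - x 0)` times a monomial in the other variables times the density: the total is zero. The
interaction contributes terms `x 0 * (1 - x 0) / (x 0 - x j)`, and averaging each over the exchange
of `x 0` and `x j` cancels the denominator, leaving a polynomial. The result is a two-term recursion
between moments of consecutive cardinalities (`moment_recursion`), and iterating it gives part (2).

For small `γ` the factor `|x i - x j| ^ (2 * γ)` is not differentiable on the diagonal. The
calculation is therefore done with `((x i - x j) ^ 2 + ε) ^ γ`. Exchanging variables then leaves a
factor `d ^ 2 / (d ^ 2 + ε)` with `d = x i - x j`, which is bounded by one and tends to one off the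
diagonal, so dominated convergence removes `ε`.

Part (1) is transported from the cube. Symmetric integrals over the alcove are `1 / N!` of those
over `[-1,1]^N`, and `x = 1 - 2u` turns the weight into Selberg's with `a = k₃(α+1)`, `b = k₃(β+1)`.
Since `y - x i = (y - 1) + 2 * u i`, the expected product is a sum of Aomoto's integrals times
powers of `y - 1`, which is the Jacobi polynomial term by term (`sum_aomoto_eq_jacobiP`). Comparing
coefficients of powers of `y` gives the expectations of `e_n`. -/

open Filter Topology

namespace JacobiEnsemble

/-! ### The beta measure on the interval -/

/-- The beta weight `t^(a-1) (1-t)^(b-1)` on `(0,1)`, extended by zero. -/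
noncomputable def betaWeight (a b : ℝ) : ℝ → ℝ :=
  (Set.Ioo (0 : ℝ) 1).indicator fun t => t ^ (a - 1) * (1 - t) ^ (b - 1)

theorem betaWeight_of_mem {a b t : ℝ} (ht : t ∈ Set.Ioo (0 : ℝ) 1) :
    betaWeight a b t = t ^ (a - 1) * (1 - t) ^ (b - 1) :=
  Set.indicator_of_mem ht _

theorem betaWeight_nonneg (a b t : ℝ) : 0 ≤ betaWeight a b t :=
  Set.indicator_nonneg (fun t ht => mul_nonneg (Real.rpow_nonneg ht.1.le _)
    (Real.rpow_nonneg (by linarith [ht.2]) _)) t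

theorem measurable_betaWeight (a b : ℝ) : Measurable (betaWeight a b) :=
  Measurable.indicator (by fun_prop) measurableSet_Ioo

theorem integrable_betaWeight {a b : ℝ} (ha : 0 < a) (hb : 0 < b) :
    Integrable (betaWeight a b) := by
  rw [betaWeight, integrable_indicator_iff measurableSet_Ioo]
  have h := Complex.betaIntegral_convergent (u := a) (v := b) (by simpa) (by simpa)
  rw [intervalIntegrable_iff_integrableOn_Ioo_of_le zero_le_one] at h
  refine h.norm.congr (ae_restrict_of_forall_mem measurableSet_Ioo fun t ht => ?_)
  have h1 : (1 : ℂ) - t = ((1 - t : ℝ) : ℂ) := by push_cast; rfl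
  beta_reduce
  rw [norm_mul, h1, Complex.norm_cpow_eq_rpow_re_of_pos ht.1,
    Complex.norm_cpow_eq_rpow_re_of_pos (by linarith [ht.2])]
  simp

/-- The beta weight as a measure on the line. -/
noncomputable def betaLaw (a b : ℝ) : Measure ℝ :=
  volume.withDensity fun t => ENNReal.ofReal (betaWeight a b t)

instance (a b : ℝ) : SigmaFinite (betaLaw a b) :=
  SigmaFinite.withDensity_ofReal _

theorem isFiniteMeasure_betaLaw {a b : ℝ} (ha : 0 < a) (hb : 0 < b) :
    IsFiniteMeasure (betaLaw a b) :=
  isFiniteMeasure_withDensity_ofReal (integrable_betaWeight ha hb).2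

theorem integral_betaLaw (a b : ℝ) (f : ℝ → ℝ) :
    ∫ t, f t ∂(betaLaw a b) = ∫ t, betaWeight a b t * f t := by
  rw [betaLaw, integral_withDensity_eq_integral_toReal_smul
    (measurable_betaWeight a b).ennreal_ofReal (by simp)]
  simp [ENNReal.toReal_ofReal, betaWeight_nonneg]

/-- Integration by parts against the beta weight. -/
theorem integral_betaLaw_deriv_eq_zero {a b : ℝ} (ha : 0 < a) (hb : 0 < b) {R R' : ℝ → ℝ}
    (hR : ∀ t, HasDerivAt R (R' t) t) (hR' : Continuous R') :
    ∫ t, (a * (1 - t) - b * t) * R t + t * (1 - t) * R' t ∂(betaLaw a b) = 0 := by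
  have hRc : Continuous R := continuous_iff_continuousAt.2 fun t => (hR t).continuousAt
  -- The antiderivative has exponents `a` and `b`, one more than the weight. Hence it is continuous
  -- on `[0,1]` and vanishes at both ends even where the weight is unbounded.
  have key : ∫ t in (0 : ℝ)..1,
      betaWeight a b t * ((a * (1 - t) - b * t) * R t + t * (1 - t) * R' t) =
      (fun t : ℝ => t ^ a * (1 - t) ^ b * R t) 1 - (fun t : ℝ => t ^ a * (1 - t) ^ b * R t) 0 := by
    refine intervalIntegral.integral_eq_sub_of_hasDerivAt_of_le
      (f := fun t : ℝ => t ^ a * (1 - t) ^ b * R t) zero_le_one ?_ ?_ ?_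
    · have h1 : Continuous fun t : ℝ => t ^ a := Real.continuous_rpow_const ha.le
      have h2 : Continuous fun t : ℝ => (1 - t) ^ b :=
        (Real.continuous_rpow_const hb.le).comp (by fun_prop)
      exact ((h1.mul h2).mul hRc).continuousOn
    · intro t ht
      have h1 := Real.hasDerivAt_rpow_const (x := t) (p := a) (Or.inl ht.1.ne')
      have h0 : (1 - t) ≠ 0 := by linarith [ht.2]
      have h2 := ((hasDerivAt_id t).const_sub 1).rpow_const (p := b) (Or.inl h0)
      refine ((h1.mul h2).mul (hR t)).congr_deriv ?_
      rw [betaWeight_of_mem ht]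
      have e1 : t ^ a = t ^ (a - 1) * t := by
        rw [← Real.rpow_add_one ht.1.ne']; simp
      have e2 : (1 - t) ^ b = (1 - t) ^ (b - 1) * (1 - t) := by
        rw [← Real.rpow_add_one h0]; simp
      simp only [id, Pi.mul_apply]
      rw [e1, e2]
      ring
    · refine ((integrable_betaWeight ha hb).intervalIntegrable).mul_continuousOn ?_
      fun_prop
  rw [integral_betaLaw (f := fun t => (a * (1 - t) - b * t) * R t + t * (1 - t) * R' t), ← setIntegral_eq_integral_of_forall_compl_eq_zero (s := Set.Ioc 0 1),
    ← intervalIntegral.integral_of_le zero_le_one, key]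
  · simp [Real.zero_rpow ha.ne', Real.zero_rpow hb.ne']
  · intro t ht
    rw [betaWeight, Set.indicator_of_notMem (fun h => ht ⟨h.1, h.2.le⟩), zero_mul]

/-! ### Product beta measures on the cube -/

/-- Products of measures with densities have the product density. -/
theorem pi_withDensity_ofReal {ι : Type*} [Fintype ι] {α : Type*} [MeasurableSpace α]
    (μ : Measure α) [SigmaFinite μ] {g : α → ℝ} (hg0 : ∀ x, 0 ≤ g x)
    (hg : Integrable g μ) :
    Measure.pi (fun _ : ι => μ.withDensity fun x => ENNReal.ofReal (g x)) =
      (Measure.pi fun _ : ι => μ).withDensity fun x => ENNReal.ofReal (∏ i, g (x i)) := by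
  have : SigmaFinite (μ.withDensity fun x => ENNReal.ofReal (g x)) :=
    SigmaFinite.withDensity_ofReal _
  refine Measure.pi_eq fun s hs => ?_
  have hgi : ∀ i, Integrable ((s i).indicator g) μ := fun i => hg.indicator (hs i)
  have hnn : ∀ i x, 0 ≤ (s i).indicator g x := fun i x =>
    Set.indicator_nonneg (fun x _ => hg0 x) x
  have h1 : ∀ i, μ.withDensity (fun x => ENNReal.ofReal (g x)) (s i) =
      ENNReal.ofReal (∫ x, (s i).indicator g x ∂μ) := fun i => by
    rw [withDensity_apply _ (hs i), integral_indicator (hs i),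
      ofReal_integral_eq_lintegral_ofReal hg.integrableOn (ae_of_all _ hg0)]
  simp_rw [h1]
  rw [← ENNReal.ofReal_prod_of_nonneg (fun i _ => integral_nonneg (hnn i)),
    ← integral_fintype_prod_eq_prod, withDensity_apply _ (MeasurableSet.univ_pi hs),
    ofReal_integral_eq_lintegral_ofReal (Integrable.fintype_prod_dep hgi)
      (ae_of_all _ fun x => Finset.prod_nonneg fun i _ => hnn i _),
    ← lintegral_indicator (MeasurableSet.univ_pi hs)]
  refine lintegral_congr fun x => ?_
  by_cases hx : x ∈ Set.univ.pi s
  · rw [Set.indicator_of_mem hx]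
    congr 1
    exact Finset.prod_congr rfl fun i _ => (Set.indicator_of_mem (hx i trivial) _).symm
  · rw [Set.indicator_of_notMem hx]
    obtain ⟨i, hi⟩ : ∃ i, x i ∉ s i := by simpa [Set.mem_pi] using hx
    rw [Finset.prod_eq_zero (Finset.mem_univ i) (Set.indicator_of_notMem hi _), ENNReal.ofReal_zero]

/-- The product of `N` beta weights as a measure on `ℝ^N`. -/
noncomputable def betaLawPi (N : ℕ) (a b : ℝ) : Measure (Fin N → ℝ) :=
  Measure.pi fun _ => betaLaw a b

theorem measurable_prod_betaWeight (N : ℕ) (a b : ℝ) :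
    Measurable fun x : Fin N → ℝ => ∏ i, betaWeight a b (x i) :=
  Finset.measurable_prod _ fun i _ => (measurable_betaWeight a b).comp (measurable_pi_apply i)

theorem betaLawPi_eq_withDensity (N : ℕ) {a b : ℝ} (ha : 0 < a) (hb : 0 < b) :
    betaLawPi N a b = volume.withDensity fun x => ENNReal.ofReal (∏ i, betaWeight a b (x i)) :=
  pi_withDensity_ofReal volume (betaWeight_nonneg a b)
    (integrable_betaWeight ha hb)

theorem isFiniteMeasure_betaLawPi (N : ℕ) {a b : ℝ} (ha : 0 < a) (hb : 0 < b) :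
    IsFiniteMeasure (betaLawPi N a b) := by
  have := isFiniteMeasure_betaLaw ha hb
  unfold betaLawPi
  infer_instance

theorem ae_mem_Ioo_betaLawPi (N : ℕ) {a b : ℝ} (ha : 0 < a) (hb : 0 < b) :
    ∀ᵐ x ∂(betaLawPi N a b), ∀ i, x i ∈ Set.Ioo (0 : ℝ) 1 := by
  rw [betaLawPi_eq_withDensity N ha hb, ae_withDensity_iff]
  · refine ae_of_all _ fun x hx i => ?_
    by_contra hi
    exact hx (by
      rw [Finset.prod_eq_zero (Finset.mem_univ i) (Set.indicator_of_notMem hi _),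
        ENNReal.ofReal_zero])
  · exact (measurable_prod_betaWeight N a b).ennreal_ofReal

/-- The measure is finite and lives on a bounded cube, where continuous functions are bounded.
Keeping the singular endpoint factors inside the measure makes most later integrability claims
instances of this. -/
theorem integrable_betaLawPi_of_continuous {N : ℕ} {a b : ℝ} (ha : 0 < a) (hb : 0 < b)
    {f : (Fin N → ℝ) → ℝ} (hf : Continuous f) : Integrable f (betaLawPi N a b) := by
  have := isFiniteMeasure_betaLawPi N ha hb
  obtain ⟨C, hC⟩ := (isCompact_Icc (a := (0 : Fin N → ℝ)) (b := 1)).exists_bound_of_continuousOn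
    hf.continuousOn
  refine Integrable.of_bound hf.aestronglyMeasurable C ?_
  filter_upwards [ae_mem_Ioo_betaLawPi N ha hb] with x hx
  exact hC x ⟨fun i => (hx i).1.le, fun i => (hx i).2.le⟩

theorem univ_pi_Ioo_ae_eq_Icc_zero_one (N : ℕ) :
    (Set.univ.pi fun i => Set.Ioo ((0 : Fin N → ℝ) i) ((1 : Fin N → ℝ) i)) =ᵐ[volume]
      Set.Icc (0 : Fin N → ℝ) 1 :=
  Measure.univ_pi_Ioo_ae_eq_Icc

theorem integral_betaLawPi {N : ℕ} {a b : ℝ} (ha : 0 < a) (hb : 0 < b) (f : (Fin N → ℝ) → ℝ) :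
    ∫ x, f x ∂(betaLawPi N a b) =
      ∫ x in Set.Icc (0 : Fin N → ℝ) 1,
        (∏ i, x i ^ (a - 1) * (1 - x i) ^ (b - 1)) * f x := by
  rw [betaLawPi_eq_withDensity N ha hb, integral_withDensity_eq_integral_toReal_smul
    (measurable_prod_betaWeight N a b).ennreal_ofReal (by simp),
    ← setIntegral_congr_set (univ_pi_Ioo_ae_eq_Icc_zero_one N),
    ← integral_indicator (MeasurableSet.univ_pi fun i => measurableSet_Ioo)]
  congr 1
  ext x
  rw [ENNReal.toReal_ofReal (Finset.prod_nonneg fun i _ => betaWeight_nonneg _ _ _)]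
  by_cases hx : x ∈ Set.univ.pi fun i => Set.Ioo ((0 : Fin N → ℝ) i) ((1 : Fin N → ℝ) i)
  · rw [Set.indicator_of_mem hx, smul_eq_mul]
    congr 1
    exact Finset.prod_congr rfl fun i _ => betaWeight_of_mem (hx i trivial)
  · rw [Set.indicator_of_notMem hx]
    obtain ⟨i, hi⟩ : ∃ i, x i ∉ Set.Ioo (0 : ℝ) 1 := by
      by_contra! h
      exact hx fun i _ => h i
    rw [Finset.prod_eq_zero (Finset.mem_univ i) (Set.indicator_of_notMem hi _), zero_smul]

theorem integrableOn_Icc_of_continuous {N : ℕ} {a b : ℝ} (ha : 0 < a) (hb : 0 < b)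
    {f : (Fin N → ℝ) → ℝ} (hf : Continuous f) :
    IntegrableOn (fun x => (∏ i, x i ^ (a - 1) * (1 - x i) ^ (b - 1)) * f x)
      (Set.Icc (0 : Fin N → ℝ) 1) := by
  have h := integrable_betaLawPi_of_continuous ha hb hf
  rw [betaLawPi_eq_withDensity N ha hb,
    integrable_withDensity_iff_integrable_smul' (measurable_prod_betaWeight N a b).ennreal_ofReal (by simp)] at h
  refine IntegrableOn.congr_set_ae ?_
    (univ_pi_Ioo_ae_eq_Icc_zero_one N).symm
  refine (h.integrableOn (s := Set.univ.pi fun i => Set.Ioo _ _)).congr_fun (fun x hx => ?_)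
    (MeasurableSet.univ_pi fun i => measurableSet_Ioo)
  simp only
  rw [ENNReal.toReal_ofReal (Finset.prod_nonneg fun i _ => betaWeight_nonneg _ _ _), smul_eq_mul]
  congr 1
  exact Finset.prod_congr rfl fun i _ => betaWeight_of_mem (hx i trivial)

/-! ### The regularized interaction and its symmetry -/

/-- The regularized interaction `∏_{i<j} ((x_i - x_j)² + ε)^γ`. -/
noncomputable def smoothInteraction (N : ℕ) (γ ε : ℝ) (x : Fin N → ℝ) : ℝ :=
  ∏ i : Fin N, ∏ j ∈ Finset.Ioi i, ((x i - x j) ^ 2 + ε) ^ γ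

theorem smoothInteraction_zero (N : ℕ) (γ : ℝ) (x : Fin N → ℝ) :
    smoothInteraction N γ 0 x = interaction N (2 * γ) x := by
  refine Finset.prod_congr rfl fun i _ => Finset.prod_congr rfl fun j _ => ?_
  rw [add_zero, Real.rpow_mul (abs_nonneg _), Real.rpow_two, sq_abs]

theorem continuous_smoothInteraction (N : ℕ) {γ : ℝ} (hγ : 0 < γ) :
    Continuous fun p : ℝ × (Fin N → ℝ) => smoothInteraction N γ p.1 p.2 :=
  continuous_finsetProd _ fun i _ => continuous_finsetProd _ fun j _ =>
    (Real.continuous_rpow_const hγ.le).comp (by fun_prop)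

theorem continuous_smoothInteraction_right (N : ℕ) {γ : ℝ} (hγ : 0 < γ) (ε : ℝ) :
    Continuous (smoothInteraction N γ ε) :=
  continuous_finsetProd _ fun i _ => continuous_finsetProd _ fun j _ =>
    (Real.continuous_rpow_const hγ.le).comp (by fun_prop)

theorem smoothInteraction_cons (M : ℕ) (γ ε t : ℝ) (y : Fin M → ℝ) :
    smoothInteraction (M + 1) γ ε (Fin.cons t y) =
      (∏ j, ((t - y j) ^ 2 + ε) ^ γ) * smoothInteraction M γ ε y := by
  simp [smoothInteraction, Fin.prod_univ_succ]

/-- A permutation does not preserve the condition `i < j`. The square of the product, however, runs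
over all ordered pairs of distinct indices, which are permuted among themselves, and nonnegativity
allows passing back to the root. -/
theorem prod_prod_Ioi_comp_perm {N : ℕ} (f : Fin N → Fin N → ℝ) (hf0 : ∀ i j, 0 ≤ f i j)
    (hf : ∀ i j, f i j = f j i) (σ : Equiv.Perm (Fin N)) :
    ∏ i, ∏ j ∈ Finset.Ioi i, f (σ i) (σ j) = ∏ i, ∏ j ∈ Finset.Ioi i, f i j := by
  have sq : ∀ g : Fin N → Fin N → ℝ, (∀ i j, g i j = g j i) →
      (∏ i, ∏ j ∈ Finset.Ioi i, g i j) ^ 2 = ∏ i, ∏ j ∈ {i}ᶜ, g j i := fun g hg => by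
    rw [← Finset.prod_prod_Ioi_mul_eq_prod_prod_off_diag, ← Finset.prod_pow]
    refine Finset.prod_congr rfl fun i _ => ?_
    rw [← Finset.prod_pow]
    exact Finset.prod_congr rfl fun j _ => by rw [hg j i, pow_two]
  have nn : ∀ g : Fin N → Fin N → ℝ, (∀ i j, 0 ≤ g i j) →
      0 ≤ ∏ i, ∏ j ∈ Finset.Ioi i, g i j := fun g hg =>
    Finset.prod_nonneg fun i _ => Finset.prod_nonneg fun j _ => hg i j
  refine (pow_left_inj₀ (nn (fun i j => f (σ i) (σ j)) fun i j => hf0 _ _) (nn f hf0)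
    two_ne_zero).1 ?_
  rw [sq (fun i j => f (σ i) (σ j)) fun i j => hf _ _, sq f hf,
    ← Equiv.prod_comp σ fun i => ∏ j ∈ {i}ᶜ, f j i]
  refine Finset.prod_congr rfl fun i _ => ?_
  exact Finset.prod_equiv σ (by simp) fun j _ => rfl

theorem smoothInteraction_comp_perm {N : ℕ} (γ : ℝ) {ε : ℝ} (hε : 0 ≤ ε) (x : Fin N → ℝ)
    (σ : Equiv.Perm (Fin N)) :
    smoothInteraction N γ ε (x ∘ σ) = smoothInteraction N γ ε x :=
  prod_prod_Ioi_comp_perm (fun i j => ((x i - x j) ^ 2 + ε) ^ γ)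
    (fun i j => Real.rpow_nonneg (by positivity) _)
    (fun i j => by rw [← neg_sub, neg_sq]) σ

theorem interaction_comp_perm {N : ℕ} (s : ℝ) (x : Fin N → ℝ) (σ : Equiv.Perm (Fin N)) :
    interaction N s (x ∘ σ) = interaction N s x :=
  prod_prod_Ioi_comp_perm (fun i j => |x i - x j| ^ s)
    (fun i j => Real.rpow_nonneg (abs_nonneg _) _)
    (fun i j => by rw [abs_sub_comm]) σ

theorem integral_betaLawPi_comp_perm {N : ℕ} {a b : ℝ} (σ : Equiv.Perm (Fin N))
    (f : (Fin N → ℝ) → ℝ) :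
    ∫ x, f (x ∘ σ) ∂(betaLawPi N a b) = ∫ x, f x ∂(betaLawPi N a b) :=
  (measurePreserving_arrowCongr' (fun _ => betaLaw a b) (fun _ => betaLaw a b) σ.symm
    (MeasurableEquiv.refl ℝ) fun _ => MeasurePreserving.id _).integral_comp' f

theorem integral_betaLawPi_succ {M : ℕ} {a b : ℝ}
    {f : (Fin (M + 1) → ℝ) → ℝ} (hf : Integrable f (betaLawPi (M + 1) a b)) :
    ∫ x, f x ∂(betaLawPi (M + 1) a b) =
      ∫ y, ∫ t, f (Fin.cons t y) ∂(betaLaw a b) ∂(betaLawPi M a b) := by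
  have mp := (measurePreserving_piFinSuccAbove (fun _ : Fin (M + 1) => betaLaw a b) 0).symm
  have : SFinite (betaLawPi M a b) := by unfold betaLawPi; infer_instance
  rw [betaLawPi, ← mp.integral_comp' f]
  have e : ∀ (t : ℝ) (y : Fin M → ℝ),
      (MeasurableEquiv.piFinSuccAbove (fun _ : Fin (M + 1) => ℝ) 0).symm (t, y) =
        (Fin.cons t y : Fin (M + 1) → ℝ) := fun t y => Fin.insertNth_zero' t y
  refine (integral_prod_symm _ ((mp.integrable_comp_emb
    (MeasurableEquiv.measurableEmbedding _)).2 hf)).trans ?_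
  simp only [Function.comp_apply, e]
  rfl

/-! ### Integration by parts and removal of the regularization -/

theorem hasDerivAt_prod_smooth {M : ℕ} (γ : ℝ) {ε : ℝ} (hε : 0 < ε) (y : Fin M → ℝ) (t : ℝ) :
    HasDerivAt (fun t => ∏ j, ((t - y j) ^ 2 + ε) ^ γ)
      ((∑ j, 2 * γ * ((t - y j) / ((t - y j) ^ 2 + ε))) * ∏ j, ((t - y j) ^ 2 + ε) ^ γ) t := by
  have h : ∀ j ∈ Finset.univ, HasDerivAt (fun t => ((t - y j) ^ 2 + ε) ^ γ)
      (2 * γ * ((t - y j) / ((t - y j) ^ 2 + ε)) * ((t - y j) ^ 2 + ε) ^ γ) t := fun j _ => by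
    have h0 : (t - y j) ^ 2 + ε ≠ 0 := by positivity
    have h1 := ((((hasDerivAt_id t).sub_const (y j)).pow 2).add_const ε).rpow_const
      (p := γ) (Or.inl h0)
    refine h1.congr_deriv ?_
    simp only [id, Pi.pow_apply]
    rw [Real.rpow_sub_one h0]
    field_simp
    push_cast
    ring
  refine (HasDerivAt.fun_finsetProd h).congr_deriv ?_
  rw [Finset.sum_mul]
  refine Finset.sum_congr rfl fun j _ => ?_
  rw [smul_eq_mul, ← Finset.mul_prod_erase Finset.univ _ (Finset.mem_univ j)]
  ring

/-- Integration by parts in the first variable against the regularized interaction. -/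
theorem integral_smooth_deriv_eq_zero {M : ℕ} {a b γ ε : ℝ} (ha : 0 < a) (hb : 0 < b)
    (hγ : 0 < γ) (hε : 0 < ε) {Q : (Fin M → ℝ) → ℝ} (hQ : Continuous Q) :
    ∫ x, (a * (1 - x 0) - b * x 0 + x 0 * (1 - x 0) *
        ∑ j : Fin M, 2 * γ * ((x 0 - x j.succ) / ((x 0 - x j.succ) ^ 2 + ε))) *
        Q (Fin.tail x) * smoothInteraction (M + 1) γ ε x ∂(betaLawPi (M + 1) a b) = 0 := by
  have hJ : Continuous (smoothInteraction (M + 1) γ ε) :=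
    continuous_smoothInteraction_right (M + 1) hγ ε
  have hne : ∀ d : ℝ, d ^ 2 + ε ≠ 0 := fun d => by positivity
  have hT : Continuous fun x : Fin (M + 1) → ℝ => Q (Fin.tail x) :=
    hQ.comp (continuous_pi fun i => continuous_apply _)
  rw [integral_betaLawPi_succ]
  · rw [integral_eq_zero_of_ae]
    refine ae_of_all _ fun y => ?_
    have hc : Continuous fun t : ℝ => (∑ j, 2 * γ * ((t - y j) / ((t - y j) ^ 2 + ε))) *
        ∏ j, ((t - y j) ^ 2 + ε) ^ γ := by
      refine Continuous.mul (continuous_finsetSum _ fun j _ => ?_)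
        (continuous_finsetProd _ fun j _ => (Real.continuous_rpow_const hγ.le).comp (by fun_prop))
      exact continuous_const.mul (Continuous.div₀ (by fun_prop) (by fun_prop) fun t => hne _)
    have h := integral_betaLaw_deriv_eq_zero ha hb (hasDerivAt_prod_smooth γ hε y) hc
    simp only [Fin.cons_zero, Fin.cons_succ, Fin.tail_cons, smoothInteraction_cons, Pi.zero_apply]
    -- The monomial factor and the interaction among the remaining variables do not depend on `t`,
    -- so the one-variable identity applies on each fibre.
    calc _ = ∫ t, Q y * smoothInteraction M γ ε y * _ ∂(betaLaw a b) :=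
          integral_congr_ae (ae_of_all _ fun t => ?_)
      _ = 0 := by rw [integral_const_mul, h, mul_zero]
    simp only
    ring
  · refine integrable_betaLawPi_of_continuous ha hb ?_
    refine Continuous.mul (Continuous.mul (Continuous.add (by fun_prop) (Continuous.mul
      (by fun_prop) (continuous_finsetSum _ fun j _ => ?_))) hT) hJ
    exact continuous_const.mul (Continuous.div₀ (by fun_prop) (by fun_prop) fun t => hne _)

theorem smoothInteraction_zero_eq_zero {N : ℕ} {γ : ℝ} (hγ : 0 < γ) {x : Fin N → ℝ} {i j : Fin N}
    (hij : i ≠ j) (hx : x i = x j) : smoothInteraction N γ 0 x = 0 := by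
  wlog h : i < j generalizing i j
  · exact this hij.symm hx.symm (lt_of_le_of_ne (not_lt.1 h) hij.symm)
  refine Finset.prod_eq_zero (Finset.mem_univ i) (Finset.prod_eq_zero (Finset.mem_Ioi.2 h) ?_)
  simp [hx, Real.zero_rpow hγ.ne']

/-- Joint continuity in `(ε, x)` on a compact set gives one constant valid for all `ε`, as dominated
convergence requires. -/
theorem exists_bound_smoothInteraction (N : ℕ) {γ : ℝ} (hγ : 0 < γ) {f : (Fin N → ℝ) → ℝ}
    (hf : Continuous f) : ∃ C, ∀ ε ∈ Set.Icc (0 : ℝ) 1, ∀ x : Fin N → ℝ,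
      (∀ i, x i ∈ Set.Ioo (0 : ℝ) 1) → |f x * smoothInteraction N γ ε x| ≤ C := by
  obtain ⟨C, hC⟩ := (isCompact_Icc.prod (isCompact_Icc (a := (0 : Fin N → ℝ)) (b := 1))
    : IsCompact (Set.Icc (0 : ℝ) 1 ×ˢ Set.Icc (0 : Fin N → ℝ) 1)).exists_bound_of_continuousOn
    (((hf.comp continuous_snd).mul (continuous_smoothInteraction N hγ)).continuousOn)
  exact ⟨C, fun ε hε x hx => hC (ε, x) ⟨hε, fun i => (hx i).1.le, fun i => (hx i).2.le⟩⟩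

theorem tendsto_smoothInteraction (N : ℕ) {γ : ℝ} (hγ : 0 < γ) (x : Fin N → ℝ) :
    Tendsto (fun ε => smoothInteraction N γ ε x) (𝓝[>] 0) (𝓝 (smoothInteraction N γ 0 x)) := by
  have h : Continuous fun ε => smoothInteraction N γ ε x :=
    continuous_finsetProd _ fun i _ => continuous_finsetProd _ fun j _ =>
      (Real.continuous_rpow_const hγ.le).comp (by fun_prop)
  exact (h.tendsto 0).mono_left nhdsWithin_le_nhds

/-- Integrals against the regularized interaction converge as the regularization is removed,
also in the presence of uniformly bounded factors that tend to one off the diagonal. -/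
theorem tendsto_integral_smoothInteraction {N : ℕ} {a b γ : ℝ} (ha : 0 < a) (hb : 0 < b)
    (hγ : 0 < γ) {f : (Fin N → ℝ) → ℝ} (hf : Continuous f) {c : ℝ → (Fin N → ℝ) → ℝ}
    (hcm : ∀ ε > 0, Continuous (c ε)) (hc1 : ∀ ε > 0, ∀ x, |c ε x| ≤ 1)
    (hc : ∀ x, smoothInteraction N γ 0 x ≠ 0 → Tendsto (fun ε => c ε x) (𝓝[>] 0) (𝓝 1)) :
    Tendsto (fun ε => ∫ x, f x * c ε x * smoothInteraction N γ ε x ∂(betaLawPi N a b)) (𝓝[>] 0)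
      (𝓝 (∫ x, f x * smoothInteraction N γ 0 x ∂(betaLawPi N a b))) := by
  have := isFiniteMeasure_betaLawPi N ha hb
  obtain ⟨C, hC⟩ := exists_bound_smoothInteraction N hγ hf
  have hev : ∀ᶠ ε : ℝ in 𝓝[>] 0, ε ∈ Set.Ioc (0 : ℝ) 1 := Ioc_mem_nhdsGT one_pos
  refine tendsto_integral_filter_of_dominated_convergence (fun _ => C) ?_ ?_
    (integrable_const C) (ae_of_all _ fun x => ?_)
  · filter_upwards [hev] with ε hε
    exact ((hf.mul (hcm ε hε.1)).mul
      (continuous_smoothInteraction_right N hγ ε)).aestronglyMeasurable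
  · filter_upwards [hev] with ε hε
    filter_upwards [ae_mem_Ioo_betaLawPi N ha hb] with x hx
    rw [Real.norm_eq_abs, mul_right_comm, abs_mul]
    exact (mul_le_of_le_one_right (abs_nonneg _) (hc1 ε hε.1 x)).trans
      (hC ε ⟨hε.1.le, hε.2⟩ x hx)
  -- Where the limiting interaction vanishes, nothing is known about the limit of `c ε x`; the bound
  -- `|c ε x| ≤ 1` suffices there.
  · by_cases h0 : smoothInteraction N γ 0 x = 0
    · rw [h0, mul_zero]
      have h1 : Tendsto (fun ε => |f x| * |smoothInteraction N γ ε x|) (𝓝[>] 0) (𝓝 0) := by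
        have := ((tendsto_smoothInteraction N hγ x).abs).const_mul |f x|
        simpa [h0] using this
      refine squeeze_zero_norm' ?_ h1
      filter_upwards [hev] with ε hε
      rw [Real.norm_eq_abs, mul_right_comm, abs_mul, ← abs_mul (f x)]
      exact mul_le_of_le_one_right (abs_nonneg _) (hc1 ε hε.1 x)
    · simpa using ((hc x h0).const_mul (f x)).mul (tendsto_smoothInteraction N hγ x)

theorem integrable_mul_smoothInteraction {N : ℕ} {a b γ : ℝ} (ha : 0 < a) (hb : 0 < b)
    (hγ : 0 < γ) (ε : ℝ) {f : (Fin N → ℝ) → ℝ} (hf : Continuous f) :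
    Integrable (fun x => f x * smoothInteraction N γ ε x) (betaLawPi N a b) :=
  integrable_betaLawPi_of_continuous ha hb (hf.mul (continuous_smoothInteraction_right N hγ ε))

/-- Both the measure and the interaction are invariant under `σ`. Symmetrizing the remaining factor
is what cancels the singular denominators. -/
theorem integral_eq_half_add_swap {N : ℕ} {a b γ ε : ℝ} (ha : 0 < a) (hb : 0 < b) (hγ : 0 < γ)
    (hε : 0 ≤ ε) {H : (Fin N → ℝ) → ℝ} (hH : Continuous H) (σ : Equiv.Perm (Fin N)) :
    2 * ∫ x, H x * smoothInteraction N γ ε x ∂(betaLawPi N a b) =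
      ∫ x, (H x + H (x ∘ σ)) * smoothInteraction N γ ε x ∂(betaLawPi N a b) := by
  have h1 : Continuous fun x : Fin N → ℝ => H (x ∘ σ) :=
    hH.comp (continuous_pi fun i => continuous_apply _)
  simp only [add_mul]
  rw [integral_add (integrable_mul_smoothInteraction ha hb hγ ε hH)
    (integrable_mul_smoothInteraction ha hb hγ ε h1), two_mul]
  congr 1
  rw [← integral_betaLawPi_comp_perm σ]
  simp only [smoothInteraction_comp_perm γ hε]

/-! ### Moments and Aomoto's recursion -/

/-- The integral of the monomial `∏_{i ∈ S} x_i` against the Selberg density. -/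
noncomputable def moment (N : ℕ) (a b γ : ℝ) (S : Finset (Fin N)) : ℝ :=
  ∫ x, (∏ i ∈ S, x i) * smoothInteraction N γ 0 x ∂(betaLawPi N a b)

theorem moment_congr_card {N : ℕ} (a b γ : ℝ) {S T : Finset (Fin N)} (h : S.card = T.card) :
    moment N a b γ S = moment N a b γ T := by
  let e : {i // i ∈ S} ≃ {i // i ∈ T} := Finset.equivOfCardEq h
  let σ := e.extendSubtype
  have hσ : T = S.map σ.toEmbedding := by
    refine (Finset.eq_of_subset_of_card_le (fun i hi => ?_) (by simp [h])).symm
    obtain ⟨j, hj, rfl⟩ := Finset.mem_map.1 hi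
    exact Equiv.extendSubtype_mem e j hj
  rw [moment, moment, ← integral_betaLawPi_comp_perm σ, hσ]
  simp [Finset.prod_map, smoothInteraction_comp_perm γ le_rfl]

/-- The average of the interaction term over the exchange of two variables. -/
theorem interaction_term_add_swap {M : ℕ} {ε : ℝ} (hε : 0 < ε) (T : Finset (Fin M)) (j : Fin M)
    (x : Fin (M + 1) → ℝ) {H : (Fin (M + 1) → ℝ) → ℝ}
    (hH : H = fun x => x 0 * (1 - x 0) * ((x 0 - x j.succ) / ((x 0 - x j.succ) ^ 2 + ε)) *
      ∏ i ∈ T, x i.succ) :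
    H x + H (x ∘ Equiv.swap 0 j.succ) =
      (if j ∈ T then -(x 0 * ∏ i ∈ T, x i.succ)
        else (1 - x 0 - x j.succ) * ∏ i ∈ T, x i.succ) *
      ((x 0 - x j.succ) ^ 2 / ((x 0 - x j.succ) ^ 2 + ε)) := by
  have h0 : (x 0 - x j.succ) ^ 2 + ε ≠ 0 := by positivity
  have h1 : (x j.succ - x 0) ^ 2 + ε = (x 0 - x j.succ) ^ 2 + ε := by ring
  have hoff : ∀ U : Finset (Fin M), j ∉ U →
      ∏ i ∈ U, x (Equiv.swap 0 j.succ i.succ) = ∏ i ∈ U, x i.succ := fun U hU =>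
    Finset.prod_congr rfl fun i hi => by
      rw [Equiv.swap_apply_of_ne_of_ne (Fin.succ_ne_zero i)]
      rintro h
      exact hU (Fin.succ_injective _ h ▸ hi)
  subst hH
  simp only [Function.comp_apply, Equiv.swap_apply_left, Equiv.swap_apply_right, h1]
  -- If `j ∈ T`, the common factor `x 0 * x j.succ` leaves `(1 - x 0) - (1 - x j.succ)`. Otherwise
  -- the difference is `x 0 * (1 - x 0) - x j.succ * (1 - x j.succ)`. Both are divisible by `x 0 - x
  -- j.succ`, which completes the square in the numerator.
  split_ifs with hj
  · rw [← Finset.mul_prod_erase T _ hj,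
      ← Finset.mul_prod_erase T (fun i => x (Equiv.swap 0 j.succ i.succ)) hj,
      hoff _ (Finset.notMem_erase j T), Equiv.swap_apply_right]
    field_simp
    ring
  · rw [hoff T hj]
    field_simp
    ring

/-- This is the limit `ε → 0` of the symmetrized integration by parts. The coefficient `2 * γ` of
the logarithmic derivative becomes `γ` through the averaging. -/
theorem moment_identity_sum {M : ℕ} {a b γ : ℝ} (ha : 0 < a) (hb : 0 < b) (hγ : 0 < γ)
    (T : Finset (Fin M)) :
    ∫ x, ((a * (1 - x 0) - b * x 0) * ∏ i ∈ T, x i.succ) * smoothInteraction (M + 1) γ 0 x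
        ∂(betaLawPi (M + 1) a b) +
      ∑ j, γ * ∫ x, (if j ∈ T then -(x 0 * ∏ i ∈ T, x i.succ)
        else (1 - x 0 - x j.succ) * ∏ i ∈ T, x i.succ) * smoothInteraction (M + 1) γ 0 x
        ∂(betaLawPi (M + 1) a b) = 0 := by
  have hS : ∀ j, Continuous fun x : Fin (M + 1) → ℝ =>
      if j ∈ T then -(x 0 * ∏ i ∈ T, x i.succ)
        else (1 - x 0 - x j.succ) * ∏ i ∈ T, x i.succ := fun j => by
    split_ifs <;> fun_prop
  have hdiv : ∀ ε > 0, ∀ j : Fin M, Continuous fun x : Fin (M + 1) → ℝ =>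
      (x 0 - x j.succ) / ((x 0 - x j.succ) ^ 2 + ε) := fun ε hε j =>
    Continuous.div₀ (by fun_prop) (by fun_prop) fun x => by positivity
  have hdiv2 : ∀ ε > 0, ∀ j : Fin M, Continuous fun x : Fin (M + 1) → ℝ =>
      (x 0 - x j.succ) ^ 2 / ((x 0 - x j.succ) ^ 2 + ε) := fun ε hε j =>
    Continuous.div₀ (by fun_prop) (by fun_prop) fun x => by positivity
  have hlim1 := tendsto_integral_smoothInteraction (c := fun _ _ => 1)
    (f := fun x : Fin (M + 1) → ℝ => (a * (1 - x 0) - b * x 0) * ∏ i ∈ T, x i.succ) ha hb hγ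
    (by fun_prop) (fun _ _ => continuous_const) (by simp) fun _ _ => tendsto_const_nhds
  have hlim2 := fun j => tendsto_integral_smoothInteraction (c := fun ε x =>
    (x 0 - x j.succ) ^ 2 / ((x 0 - x j.succ) ^ 2 + ε)) ha hb hγ (hS j)
    (fun ε hε => hdiv2 ε hε j) (fun ε hε x => by
      rw [abs_of_nonneg (by positivity)]
      exact div_le_one_of_le₀ (by linarith) (by positivity)) fun x hx => by
      have hd : (x 0 - x j.succ) ^ 2 ≠ 0 := pow_ne_zero _ (sub_ne_zero.2 fun h =>
        hx (smoothInteraction_zero_eq_zero hγ (Fin.succ_ne_zero j).symm h))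
      have : ContinuousAt (fun ε => (x 0 - x j.succ) ^ 2 / ((x 0 - x j.succ) ^ 2 + ε)) 0 :=
        ContinuousAt.div₀ (by fun_prop) (by fun_prop) (by simpa using hd)
      have h := this.tendsto.mono_left (nhdsWithin_le_nhds (s := Set.Ioi 0))
      simpa [div_self hd] using h
  have hlim := hlim1.add (tendsto_finsetSum Finset.univ fun j _ => (hlim2 j).const_mul γ)
  -- For every `ε > 0` the regularized expression is exactly zero, so its limit is zero.
  refine tendsto_nhds_unique hlim (tendsto_const_nhds.congr' ?_)
  filter_upwards [self_mem_nhdsWithin] with ε hε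
  have hε : 0 < ε := hε
  have hJ := continuous_smoothInteraction_right (M + 1) hγ ε
  have hbase := integral_smooth_deriv_eq_zero (Q := fun y => ∏ i ∈ T, y i) ha hb hγ hε
    (by fun_prop)
  have hHc : ∀ j : Fin M, Continuous fun x : Fin (M + 1) → ℝ =>
      x 0 * (1 - x 0) * ((x 0 - x j.succ) / ((x 0 - x j.succ) ^ 2 + ε)) * ∏ i ∈ T, x i.succ :=
    fun j => ((by fun_prop : Continuous fun x : Fin (M + 1) → ℝ => x 0 * (1 - x 0)).mul
      (hdiv ε hε j)).mul (by fun_prop)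
  have hsym : ∀ j : Fin M, γ * ∫ x, (if j ∈ T then -(x 0 * ∏ i ∈ T, x i.succ)
        else (1 - x 0 - x j.succ) * ∏ i ∈ T, x i.succ) *
        ((x 0 - x j.succ) ^ 2 / ((x 0 - x j.succ) ^ 2 + ε)) * smoothInteraction (M + 1) γ ε x
        ∂(betaLawPi (M + 1) a b) = ∫ x, 2 * γ *
        (x 0 * (1 - x 0) * ((x 0 - x j.succ) / ((x 0 - x j.succ) ^ 2 + ε)) * (∏ i ∈ T, x i.succ) *
        smoothInteraction (M + 1) γ ε x) ∂(betaLawPi (M + 1) a b) := fun j => by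
    rw [integral_const_mul, mul_right_comm, mul_comm _ γ,
      integral_eq_half_add_swap ha hb hγ hε.le (hHc j) (Equiv.swap 0 j.succ)]
    simp only [interaction_term_add_swap hε T j _ rfl]
  simp_rw [hsym]
  rw [← integral_finsetSum, ← integral_add, ← hbase]
  · refine integral_congr_ae (ae_of_all _ fun x => ?_)
    simp only [Fin.tail, add_mul, Finset.mul_sum, Finset.sum_mul, mul_one]
    congr 1
    refine Finset.sum_congr rfl fun j _ => ?_
    ring
  · refine integrable_betaLawPi_of_continuous ha hb ?_
    fun_prop
  · refine integrable_betaLawPi_of_continuous ha hb (continuous_finsetSum _ fun j _ => ?_)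
    exact continuous_const.mul ((hHc j).mul hJ)
  · exact fun j _ => integrable_betaLawPi_of_continuous ha hb
      (continuous_const.mul ((hHc j).mul hJ))

theorem moment_map_succ {M : ℕ} (a b γ : ℝ) (T : Finset (Fin M)) :
    moment (M + 1) a b γ (T.map (Fin.succEmb M)) =
      ∫ x, (∏ i ∈ T, x i.succ) * smoothInteraction (M + 1) γ 0 x ∂(betaLawPi (M + 1) a b) := by
  simp [moment, Finset.prod_map]

theorem moment_cons_map_succ {M : ℕ} (a b γ : ℝ) (T : Finset (Fin M)) (j : Fin (M + 1))
    (hj : j ∉ T.map (Fin.succEmb M)) :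
    moment (M + 1) a b γ (Finset.cons j (T.map (Fin.succEmb M)) hj) =
      ∫ x, (x j * ∏ i ∈ T, x i.succ) * smoothInteraction (M + 1) γ 0 x
        ∂(betaLawPi (M + 1) a b) := by
  simp only [moment, Finset.prod_cons, Finset.prod_map, Fin.coe_succEmb]

/-- Aomoto's recursion for the moments of the Selberg density. -/
theorem moment_recursion {M : ℕ} {a b γ : ℝ} (ha : 0 < a) (hb : 0 < b) (hγ : 0 < γ)
    {S T : Finset (Fin (M + 1))} {n : ℕ} (hn : n ≤ M) (hS : S.card = n) (hT : T.card = n + 1) :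
    (a + b + γ * (n + 2 * (M - n))) * moment (M + 1) a b γ T =
      (a + γ * (M - n)) * moment (M + 1) a b γ S := by
  -- The representative index set avoids the variable `x 0`, which is the one integrated by parts.
  obtain ⟨U, -, hU⟩ := Finset.exists_subset_card_eq
    (show n ≤ (Finset.univ : Finset (Fin M)).card by simpa using hn)
  set m₀ := moment (M + 1) a b γ S with hm₀
  set m₁ := moment (M + 1) a b γ T with hm₁
  have e0 : ∫ x, (∏ i ∈ U, x i.succ) * smoothInteraction (M + 1) γ 0 x
      ∂(betaLawPi (M + 1) a b) = m₀ := by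
    rw [← moment_map_succ, hm₀]
    exact moment_congr_card a b γ (by simp [hU, hS])
  have e1 : ∀ j : Fin (M + 1), j ∉ U.map (Fin.succEmb M) →
      ∫ x, (x j * ∏ i ∈ U, x i.succ) * smoothInteraction (M + 1) γ 0 x
        ∂(betaLawPi (M + 1) a b) = m₁ := fun j hj => by
    rw [← moment_cons_map_succ a b γ U j hj, hm₁]
    exact moment_congr_card a b γ (by rw [Finset.card_cons, Finset.card_map, hU, hT])
  have hz : (0 : Fin (M + 1)) ∉ U.map (Fin.succEmb M) := by simp [Fin.succ_ne_zero]
  have i0 := integrable_mul_smoothInteraction (N := M + 1) (a := a) (b := b) ha hb hγ 0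
    (f := fun x => ∏ i ∈ U, x i.succ) (by fun_prop)
  have i1 := fun j : Fin (M + 1) => integrable_mul_smoothInteraction (N := M + 1) (a := a)
    (b := b) ha hb hγ 0 (f := fun x => x j * ∏ i ∈ U, x i.succ) (by fun_prop)
  have h := moment_identity_sum ha hb hγ U
  have t0 : ∫ x, ((a * (1 - x 0) - b * x 0) * ∏ i ∈ U, x i.succ) *
      smoothInteraction (M + 1) γ 0 x ∂(betaLawPi (M + 1) a b) = a * m₀ - (a + b) * m₁ := by
    rw [← e0, ← e1 0 hz, ← integral_const_mul, ← integral_const_mul,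
      ← integral_sub (i0.const_mul a) ((i1 0).const_mul (a + b))]
    refine integral_congr_ae (ae_of_all _ fun x => ?_)
    ring
  have t1 : ∀ j : Fin M, ∫ x, (if j ∈ U then -(x 0 * ∏ i ∈ U, x i.succ)
        else (1 - x 0 - x j.succ) * ∏ i ∈ U, x i.succ) * smoothInteraction (M + 1) γ 0 x
        ∂(betaLawPi (M + 1) a b) = if j ∈ U then -m₁ else m₀ - 2 * m₁ := fun j => by
    split_ifs with hj
    · rw [← e1 0 hz, ← integral_neg]
      refine integral_congr_ae (ae_of_all _ fun x => ?_)
      ring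
    · have hjs : j.succ ∉ U.map (Fin.succEmb M) := by simpa using hj
      have i2 : Integrable (fun x => (∏ i ∈ U, x i.succ) * smoothInteraction (M + 1) γ 0 x -
            (x 0 * ∏ i ∈ U, x i.succ) * smoothInteraction (M + 1) γ 0 x)
            (betaLawPi (M + 1) a b) := i0.sub (i1 0)
      calc _ = ∫ x, ((∏ i ∈ U, x i.succ) * smoothInteraction (M + 1) γ 0 x -
            (x 0 * ∏ i ∈ U, x i.succ) * smoothInteraction (M + 1) γ 0 x) -
            (x j.succ * ∏ i ∈ U, x i.succ) * smoothInteraction (M + 1) γ 0 x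
            ∂(betaLawPi (M + 1) a b) := by
            refine integral_congr_ae (ae_of_all _ fun x => ?_)
            ring
        _ = _ := by
            rw [integral_sub i2 (i1 j.succ), integral_sub i0 (i1 0), e0, e1 0 hz,
              e1 _ hjs]
            ring
  have hc : (Uᶜ.card : ℝ) = M - n := by
    rw [Finset.card_compl, hU, Fintype.card_fin, Nat.cast_sub hn]
  rw [t0] at h
  simp only [t1] at h
  -- The `n` indices in `U` contribute `-m₁` each, the other `M - n` contribute `m₀ - 2 * m₁`.
  rw [← Finset.mul_sum, ← Finset.sum_add_sum_compl U, Finset.sum_congr rfl fun i hi => if_pos hi,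
    Finset.sum_congr (s₁ := Uᶜ) rfl fun i hi => if_neg (Finset.mem_compl.1 hi), Finset.sum_const,
    Finset.sum_const, nsmul_eq_mul, nsmul_eq_mul, hc, hU] at h
  linarith

/-! ### Selberg's integral: positivity and Aomoto's formula -/

theorem integral_mul_selbergWeight {N : ℕ} {a b γ : ℝ} (ha : 0 < a) (hb : 0 < b)
    (f : (Fin N → ℝ) → ℝ) :
    ∫ u in Set.Icc (0 : Fin N → ℝ) 1, f u * selbergWeight N a b γ u =
      ∫ x, f x * smoothInteraction N γ 0 x ∂(betaLawPi N a b) := by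
  rw [integral_betaLawPi ha hb]
  refine integral_congr_ae (ae_of_all _ fun x => ?_)
  simp only [selbergWeight, smoothInteraction_zero]
  ring

theorem integrableOn_mul_selbergWeight {N : ℕ} {a b γ : ℝ} (ha : 0 < a) (hb : 0 < b) (hγ : 0 < γ)
    {f : (Fin N → ℝ) → ℝ} (hf : Continuous f) :
    IntegrableOn (fun u => f u * selbergWeight N a b γ u) (Set.Icc (0 : Fin N → ℝ) 1) := by
  refine (integrableOn_Icc_of_continuous ha hb
    (hf.mul (continuous_smoothInteraction_right N hγ 0))).congr (ae_of_all _ fun x => ?_)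
  simp only [selbergWeight, Pi.mul_apply, smoothInteraction_zero]
  ring

theorem interaction_nonneg (N : ℕ) (s : ℝ) (x : Fin N → ℝ) : 0 ≤ interaction N s x :=
  Finset.prod_nonneg fun _ _ => Finset.prod_nonneg fun _ _ => Real.rpow_nonneg (abs_nonneg _) _

theorem interaction_eq_zero {N : ℕ} {s : ℝ} (hs : 0 < s) {x : Fin N → ℝ}
    (hx : ¬ Function.Injective x) : interaction N s x = 0 := by
  obtain ⟨i, j, h, hij⟩ : ∃ i j, x i = x j ∧ i ≠ j := by
    simpa [Function.Injective] using hx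
  have := smoothInteraction_zero_eq_zero (half_pos hs) hij h
  rwa [smoothInteraction_zero, mul_div_cancel₀ _ two_ne_zero] at this

theorem integral_selbergWeight_pos {N : ℕ} {a b γ : ℝ} (ha : 0 < a) (hb : 0 < b) (hγ : 0 < γ) :
    0 < ∫ u in Set.Icc (0 : Fin N → ℝ) 1, selbergWeight N a b γ u := by
  have hi : IntegrableOn (selbergWeight N a b γ) (Set.Icc (0 : Fin N → ℝ) 1) := by
    simpa using integrableOn_mul_selbergWeight (N := N) ha hb hγ (continuous_const (y := (1 : ℝ)))
  have hnn : 0 ≤ᵐ[volume.restrict (Set.Icc (0 : Fin N → ℝ) 1)] selbergWeight N a b γ :=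
    ae_restrict_of_forall_mem measurableSet_Icc fun x hx => mul_nonneg
      (Finset.prod_nonneg fun i _ => mul_nonneg (Real.rpow_nonneg (hx.1 i) _)
        (Real.rpow_nonneg (sub_nonneg.2 (hx.2 i)) _)) (interaction_nonneg _ _ _)
  rw [setIntegral_pos_iff_support_of_nonneg_ae hnn hi]
  -- On this nonempty open set of strictly increasing interior points every factor of the weight is
  -- positive.
  let U : Set (Fin N → ℝ) := (⋂ i, {x | 0 < x i}) ∩ (⋂ i, {x | x i < 1}) ∩
    ⋂ i, ⋂ j, ⋂ _ : i < j, {x | x i < x j}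
  have hU : IsOpen U := by
    refine ((isOpen_iInter_of_finite fun i => ?_).inter (isOpen_iInter_of_finite fun i => ?_)).inter
      (isOpen_iInter_of_finite fun i => isOpen_iInter_of_finite fun j =>
        isOpen_iInter_of_finite fun _ => ?_)
    exacts [isOpen_lt (by fun_prop) (by fun_prop), isOpen_lt (by fun_prop) (by fun_prop),
      isOpen_lt (by fun_prop) (by fun_prop)]
  have hne : U.Nonempty := by
    refine ⟨fun i => ((i : ℕ) + 1 : ℝ) / (N + 1), ?_⟩
    simp only [U, Set.mem_inter_iff, Set.mem_iInter, Set.mem_ofPred_eq]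
    refine ⟨⟨fun i => by positivity, fun i => ?_⟩, fun i j hij => ?_⟩
    · rw [div_lt_one (by positivity)]
      have : ((i : ℕ) : ℝ) < N := by exact_mod_cast i.2
      linarith
    · have : ((i : ℕ) : ℝ) < (j : ℕ) := by exact_mod_cast hij
      gcongr
  refine (hU.measure_pos volume hne).trans_le (measure_mono fun x hx => ?_)
  simp only [U, Set.mem_inter_iff, Set.mem_iInter, Set.mem_ofPred_eq] at hx
  obtain ⟨⟨h0, h1⟩, h2⟩ := hx
  refine ⟨ne_of_gt ?_, fun i => (h0 i).le, fun i => (h1 i).le⟩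
  refine mul_pos (Finset.prod_pos fun i _ => mul_pos (Real.rpow_pos_of_pos (h0 i) _)
    (Real.rpow_pos_of_pos (sub_pos.2 (h1 i)) _))
    (Finset.prod_pos fun i _ => Finset.prod_pos fun j hj => Real.rpow_pos_of_pos ?_ _)
  exact abs_pos.2 (sub_ne_zero.2 (h2 i j (Finset.mem_Ioi.1 hj)).ne)

theorem e_eq_sum (N n : ℕ) (x : Fin N → ℝ) :
    e N n x = ∑ S ∈ Finset.powersetCard n Finset.univ, ∏ i ∈ S, x i := by
  simp [e, MvPolynomial.esymm]

theorem continuous_e (N n : ℕ) : Continuous (e N n) := by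
  have : e N n = fun x => ∑ S ∈ Finset.powersetCard n Finset.univ, ∏ i ∈ S, x i :=
    funext (e_eq_sum N n)
  rw [this]
  fun_prop

theorem e_comp_perm {N : ℕ} (n : ℕ) (x : Fin N → ℝ) (σ : Equiv.Perm (Fin N)) :
    e N n (x ∘ σ) = e N n x := by
  rw [e, e, ← MvPolynomial.eval_rename, MvPolynomial.rename_esymm]

theorem moment_eq_prod {N : ℕ} {a b γ : ℝ} (ha : 0 < a) (hb : 0 < b) (hγ : 0 < γ) :
    ∀ (n : ℕ) (S : Finset (Fin N)), S.card = n → moment N a b γ S =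
      (∏ j ∈ Finset.Icc 1 n, (a + ((N : ℝ) - j) * γ) / (a + b + (2 * (N : ℝ) - j - 1) * γ)) *
        moment N a b γ ∅
  | 0, S, hS => by rw [Finset.card_eq_zero.1 hS]; simp
  | n + 1, S, hS => by
    have hle : n + 1 ≤ N := by simpa [hS] using S.card_le_univ
    obtain ⟨M, rfl⟩ : ∃ M, N = M + 1 := ⟨N - 1, by omega⟩
    obtain ⟨T, -, hT⟩ := Finset.exists_subset_card_eq (show n ≤ S.card by omega)
    have hn : (n : ℝ) ≤ M := by exact_mod_cast (by omega : n ≤ M)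
    have h := moment_recursion ha hb hγ (by omega) hT hS
    -- With `N = M + 1` and `j = n + 1`, this is the denominator `a + b + (2N - j - 1)γ` of the new
    -- factor.
    have hpos : 0 < a + b + γ * (n + 2 * (M - n)) := by
      have : 0 ≤ γ * (n + 2 * (M - n)) := mul_nonneg hγ.le (by linarith [n.cast_nonneg (α := ℝ)])
      linarith
    rw [Finset.prod_Icc_succ_top (by omega), mul_right_comm, ← moment_eq_prod ha hb hγ n T hT,
      mul_div_assoc', eq_div_iff]
    · push_cast
      linear_combination h
    · refine ne_of_gt (hpos.trans_eq ?_)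
      push_cast
      ring

/-- Aomoto's extension of Selberg's integral. -/
theorem integral_e_mul_selbergWeight {N : ℕ} {a b γ : ℝ} (ha : 0 < a) (hb : 0 < b) (hγ : 0 < γ)
    (n : ℕ) :
    ∫ u in Set.Icc (0 : Fin N → ℝ) 1, e N n u * selbergWeight N a b γ u =
      ((N.choose n : ℝ) * ∏ j ∈ Finset.Icc 1 n,
        (a + ((N : ℝ) - j) * γ) / (a + b + (2 * (N : ℝ) - j - 1) * γ)) *
        ∫ u in Set.Icc (0 : Fin N → ℝ) 1, selbergWeight N a b γ u := by
  have h0 : ∫ u in Set.Icc (0 : Fin N → ℝ) 1, selbergWeight N a b γ u = moment N a b γ ∅ := by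
    simpa [moment] using integral_mul_selbergWeight (N := N) (γ := γ) ha hb fun _ => 1
  rw [h0, integral_mul_selbergWeight ha hb]
  simp only [e_eq_sum, Finset.sum_mul]
  rw [integral_finsetSum _ fun S _ => integrable_mul_smoothInteraction ha hb hγ 0 (by fun_prop)]
  refine (Finset.sum_congr rfl fun S hS =>
    moment_eq_prod ha hb hγ n S (Finset.mem_powersetCard.1 hS).2).trans ?_
  rw [Finset.sum_const, Finset.card_powersetCard, Finset.card_univ, Fintype.card_fin, nsmul_eq_mul]
  ring

/-! ### From the alcove to the cube -/

/-- The integral of a symmetric function that vanishes on tuples with repetitions is `N!` times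
its integral over nondecreasing tuples. -/
theorem integral_eq_factorial_mul_monotone {N : ℕ} {F : (Fin N → ℝ) → ℝ} (hF : Integrable F)
    (hsym : ∀ x (σ : Equiv.Perm (Fin N)), F (x ∘ σ) = F x)
    (h0 : ∀ x, ¬ Function.Injective x → F x = 0) :
    ∫ x, F x = (N.factorial : ℝ) * ∫ x in {x | Monotone x}, F x := by
  have hm : MeasurableSet {x : Fin N → ℝ | Monotone x} := isClosed_monotone.measurableSet
  let G := Set.indicator {x : Fin N → ℝ | Monotone x} F
  have mp : ∀ σ : Equiv.Perm (Fin N), MeasurePreserving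
      (MeasurableEquiv.arrowCongr' σ.symm (MeasurableEquiv.refl ℝ)) volume volume := fun σ =>
    volume_preserving_arrowCongr' σ.symm (MeasurableEquiv.refl ℝ) (MeasurePreserving.id _)
  have hG : Integrable G := hF.indicator hm
  -- For pairwise distinct coordinates exactly one permutation, the sorting one, gives a monotone
  -- tuple; with repetitions both sides vanish.
  have hsum : ∀ x, F x = ∑ σ : Equiv.Perm (Fin N), G (x ∘ σ) := fun x => by
    by_cases hx : Function.Injective x
    · rw [Finset.sum_eq_single (Tuple.sort x)]
      · exact ((Set.indicator_of_mem (show x ∘ Tuple.sort x ∈ {x | Monotone x} from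
          Tuple.monotone_sort x) F).trans (hsym _ _)).symm
      · intro σ _ hσ
        refine Set.indicator_of_notMem (fun h : Monotone (x ∘ σ) => hσ ?_) F
        have := Tuple.unique_monotone h (Tuple.monotone_sort x)
        exact Equiv.ext fun i => hx (congrFun this i)
      · simp
    · rw [h0 x hx, Finset.sum_eq_zero fun σ _ => ?_]
      have : F (x ∘ σ) = 0 := by rw [hsym, h0 x hx]
      simp [G, Set.indicator_apply, this]
  calc ∫ x, F x = ∫ x, ∑ σ : Equiv.Perm (Fin N), G (x ∘ σ) := by simp_rw [← hsum]
    _ = ∑ σ : Equiv.Perm (Fin N), ∫ x, G (x ∘ σ) := integral_finsetSum _ fun σ _ =>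
        (mp σ).integrable_comp_emb (MeasurableEquiv.measurableEmbedding _) |>.2 hG
    _ = ∑ σ : Equiv.Perm (Fin N), ∫ x, G x :=
        Finset.sum_congr rfl fun σ _ => (mp σ).integral_comp' G
    _ = _ := by
        rw [Finset.sum_const, Finset.card_univ, Fintype.card_perm, Fintype.card_fin, nsmul_eq_mul,
          integral_indicator hm]

theorem weight_comp_perm {N : ℕ} (k₁ k₂ k₃ : ℝ) (x : Fin N → ℝ) (σ : Equiv.Perm (Fin N)) :
    weight N k₁ k₂ k₃ (x ∘ σ) = weight N k₁ k₂ k₃ x := by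
  rw [weight, weight, interaction_comp_perm]
  congr 1
  exact Equiv.prod_comp σ fun i => (1 - x i) ^ (k₁ + k₂ - 1 / 2) * (1 + x i) ^ (k₂ - 1 / 2)

/-- The affine substitution `x = 1 - 2u` turns the Jacobi weight into the Selberg weight. -/
theorem exists_weight_one_sub_two_smul (N : ℕ) (k₁ k₂ k₃ : ℝ) :
    ∃ K > 0, ∀ u ∈ Set.Icc (0 : Fin N → ℝ) 1, weight N k₁ k₂ k₃ (1 - (2 : ℝ) • u) =
      K * selbergWeight N (k₁ + k₂ + 1 / 2) (k₂ + 1 / 2) k₃ u := by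
  -- Each of `1 - x i = 2 * u i`, `1 + x i = 2 * (1 - u i)` and `|x i - x j| = 2 * |u i - u j|`
  -- releases a power of two.
  refine ⟨(∏ _i : Fin N, (2 : ℝ) ^ (k₁ + k₂ - 1 / 2) * 2 ^ (k₂ - 1 / 2)) *
    ∏ i : Fin N, ∏ _j ∈ Finset.Ioi i, (2 : ℝ) ^ (2 * k₃), by positivity, fun u hu => ?_⟩
  have h1 : ∀ i, 0 ≤ 1 - u i := fun i => sub_nonneg.2 (hu.2 i)
  rw [weight, selbergWeight, mul_mul_mul_comm]
  refine congr_arg₂ (fun p q : ℝ => p * q) ?_ ?_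
  · rw [← Finset.prod_mul_distrib]
    refine Finset.prod_congr rfl fun i _ => ?_
    have e1 : 1 - (1 - (2 : ℝ) • u) i = 2 * u i := by simp
    have e2 : 1 + (1 - (2 : ℝ) • u) i = 2 * (1 - u i) := by
      simp only [Pi.sub_apply, Pi.one_apply, Pi.smul_apply, smul_eq_mul]
      ring
    rw [e1, e2, Real.mul_rpow zero_le_two (hu.1 i), Real.mul_rpow zero_le_two (h1 i),
      mul_mul_mul_comm, show k₁ + k₂ + 1 / 2 - 1 = k₁ + k₂ - 1 / 2 by ring,
      show k₂ + 1 / 2 - 1 = k₂ - 1 / 2 by ring]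
  · rw [interaction, interaction, ← Finset.prod_mul_distrib]
    refine Finset.prod_congr rfl fun i _ => ?_
    rw [← Finset.prod_mul_distrib]
    refine Finset.prod_congr rfl fun j _ => ?_
    have e1 : (1 - (2 : ℝ) • u) i - (1 - (2 : ℝ) • u) j = -2 * (u i - u j) := by
      simp only [Pi.sub_apply, Pi.one_apply, Pi.smul_apply, smul_eq_mul]
      ring
    rw [e1, abs_mul, Real.mul_rpow (abs_nonneg _) (abs_nonneg _)]
    simp

theorem one_sub_two_smul_mem_Icc {N : ℕ} (u : Fin N → ℝ) :
    1 - (2 : ℝ) • u ∈ Set.Icc (-1 : Fin N → ℝ) 1 ↔ u ∈ Set.Icc (0 : Fin N → ℝ) 1 := by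
  simp only [Set.mem_Icc, Pi.le_def, Pi.sub_apply, Pi.one_apply, Pi.smul_apply, smul_eq_mul,
    Pi.neg_apply, Pi.zero_apply]
  constructor
  · exact fun h => ⟨fun i => by linarith [h.2 i], fun i => by linarith [h.1 i]⟩
  · exact fun h => ⟨fun i => by linarith [h.2 i], fun i => by linarith [h.1 i]⟩

theorem alcove_eq (N : ℕ) :
    alcove N = {x | Monotone x} ∩ Set.Icc (-1 : Fin N → ℝ) 1 := by
  ext x
  simp only [alcove, Set.mem_Icc, Set.mem_inter_iff, Set.mem_ofPred_eq, Pi.le_def, Pi.neg_apply,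
    Pi.one_apply]
  constructor
  · exact fun h => ⟨h.2, fun i => (h.1 i).1, fun i => (h.1 i).2⟩
  · exact fun h => ⟨fun i => ⟨h.2.1 i, h.2.2 i⟩, h.1⟩

theorem integrable_indicator_mul_weight (N : ℕ) {k₁ k₂ k₃ : ℝ} (hk₃ : 0 < k₃)
    (hk₂ : -1 / 2 < k₂) (hk₁₂ : -1 / 2 < k₁ + k₂) {f : (Fin N → ℝ) → ℝ} (hf : Continuous f) :
    Integrable ((Set.Icc (-1 : Fin N → ℝ) 1).indicator fun x => f x * weight N k₁ k₂ k₃ x) := by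
  obtain ⟨K, -, hw⟩ := exists_weight_one_sub_two_smul N k₁ k₂ k₃
  have h := integrableOn_mul_selbergWeight (N := N) (a := k₁ + k₂ + 1 / 2) (b := k₂ + 1 / 2)
    (by linarith) (by linarith) hk₃
    (hf.comp (by fun_prop : Continuous fun u : Fin N → ℝ => 1 - (2 : ℝ) • u))
  rw [← integrable_indicator_iff measurableSet_Icc] at h
  rw [← integrable_comp_sub_left _ 1, ← integrable_comp_smul_iff _ _ (two_ne_zero (α := ℝ))]
  refine (h.const_mul K).congr (ae_of_all _ fun u => ?_)
  by_cases hu : u ∈ Set.Icc (0 : Fin N → ℝ) 1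
  · simp only [Set.indicator_of_mem hu, Set.indicator_of_mem ((one_sub_two_smul_mem_Icc u).2 hu),
      hw u hu, Function.comp_apply]
    ring
  · simp only [Set.indicator_of_notMem hu,
      Set.indicator_of_notMem (mt (one_sub_two_smul_mem_Icc u).1 hu), mul_zero]

theorem integrableOn_alcove_mul_weight (N : ℕ) {k₁ k₂ k₃ : ℝ} (hk₃ : 0 < k₃)
    (hk₂ : -1 / 2 < k₂) (hk₁₂ : -1 / 2 < k₁ + k₂) {f : (Fin N → ℝ) → ℝ} (hf : Continuous f) :
    IntegrableOn (fun x => f x * weight N k₁ k₂ k₃ x) (alcove N) := by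
  have h := integrable_indicator_mul_weight N hk₃ hk₂ hk₁₂ hf
  rw [integrable_indicator_iff measurableSet_Icc] at h
  rw [alcove_eq]
  exact h.mono_set Set.inter_subset_right

/-- Integrals of symmetric functions over the alcove are Selberg integrals. -/
theorem exists_integral_alcove_eq (N : ℕ) {k₁ k₂ k₃ : ℝ} (hk₃ : 0 < k₃)
    (hk₂ : -1 / 2 < k₂) (hk₁₂ : -1 / 2 < k₁ + k₂) :
    ∃ K > 0, ∀ f : (Fin N → ℝ) → ℝ, Continuous f →
      (∀ x (σ : Equiv.Perm (Fin N)), f (x ∘ σ) = f x) →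
      ∫ x in alcove N, f x * weight N k₁ k₂ k₃ x =
        K * ∫ u in Set.Icc (0 : Fin N → ℝ) 1, f (1 - (2 : ℝ) • u) *
          selbergWeight N (k₁ + k₂ + 1 / 2) (k₂ + 1 / 2) k₃ u := by
  obtain ⟨K, hK, hw⟩ := exists_weight_one_sub_two_smul N k₁ k₂ k₃
  -- The constant combines the Jacobian `2 ^ N` of `x = 1 - 2u`, the ratio `K` of the weights and
  -- the `N!` orderings.
  refine ⟨2 ^ N * K / N.factorial, by positivity, fun f hf hsym => ?_⟩
  set F := (Set.Icc (-1 : Fin N → ℝ) 1).indicator fun x => f x * weight N k₁ k₂ k₃ x with hFdef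
  have hmem : ∀ (x : Fin N → ℝ) (σ : Equiv.Perm (Fin N)),
      x ∘ σ ∈ Set.Icc (-1 : Fin N → ℝ) 1 ↔ x ∈ Set.Icc (-1 : Fin N → ℝ) 1 := fun x σ => by
    constructor
    · exact fun h => ⟨fun i => by simpa using h.1 (σ.symm i), fun i => by
        simpa using h.2 (σ.symm i)⟩
    · exact fun h => ⟨fun i => h.1 (σ i), fun i => h.2 (σ i)⟩
  have h1 := integral_eq_factorial_mul_monotone (F := F)
    (integrable_indicator_mul_weight N hk₃ hk₂ hk₁₂ hf) (fun x σ => by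
      classical
      simp only [hFdef, Set.indicator_apply, hmem, hsym, weight_comp_perm]) (fun x hx => by
      simp [hFdef, weight, interaction_eq_zero (mul_pos two_pos hk₃) hx])
  rw [hFdef, setIntegral_indicator measurableSet_Icc, ← alcove_eq, ← hFdef] at h1
  have h2 : ∫ u, F (1 - (2 : ℝ) • u) = ((2 : ℝ) ^ N)⁻¹ * ∫ x, F x := by
    rw [Measure.integral_comp_smul volume (fun v => F (1 - v)) 2,
      integral_sub_left_eq_self F volume 1]
    simp
  have h3 : ∫ u, F (1 - (2 : ℝ) • u) = K * ∫ u in Set.Icc (0 : Fin N → ℝ) 1,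
      f (1 - (2 : ℝ) • u) * selbergWeight N (k₁ + k₂ + 1 / 2) (k₂ + 1 / 2) k₃ u := by
    rw [← integral_const_mul, ← integral_indicator measurableSet_Icc]
    refine integral_congr_ae (ae_of_all _ fun u => ?_)
    by_cases hu : u ∈ Set.Icc (0 : Fin N → ℝ) 1
    · simp only [hFdef, Set.indicator_of_mem hu,
        Set.indicator_of_mem ((one_sub_two_smul_mem_Icc u).2 hu), hw u hu]
      ring
    · simp only [hFdef, Set.indicator_of_notMem hu,
        Set.indicator_of_notMem (mt (one_sub_two_smul_mem_Icc u).1 hu)]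
  rw [h3, h1] at h2
  have hN : (N.factorial : ℝ) ≠ 0 := by positivity
  field_simp at h2 ⊢
  linarith

/-! ### Elementary symmetric polynomials and rising factorials -/

theorem prod_add_eq_sum_e {N : ℕ} (z : ℝ) (x : Fin N → ℝ) :
    ∏ i, (z + x i) = ∑ n ∈ Finset.range (N + 1), e N n x * z ^ (N - n) := by
  simp_rw [add_comm z]
  rw [Finset.prod_add, Finset.sum_powerset, Finset.card_univ, Fintype.card_fin]
  refine Finset.sum_congr rfl fun n _ => ?_
  rw [e_eq_sum, Finset.sum_mul]
  refine Finset.sum_congr rfl fun S hS => ?_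
  rw [Finset.prod_const, Finset.card_sdiff_of_subset (Finset.subset_univ S),
    (Finset.mem_powersetCard.1 hS).2, Finset.card_univ, Fintype.card_fin]

theorem e_const_mul {N : ℕ} (n : ℕ) (c : ℝ) (x : Fin N → ℝ) :
    e N n (fun i => c * x i) = c ^ n * e N n x := by
  simp_rw [e_eq_sum, Finset.mul_sum]
  refine Finset.sum_congr rfl fun S hS => ?_
  rw [Finset.prod_mul_distrib, Finset.prod_const, (Finset.mem_powersetCard.1 hS).2]

theorem rising_succ_left (x : ℝ) (n : ℕ) : rising x (n + 1) = x * rising (x + 1) n := by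
  simp [rising, ascPochhammer_succ_left]

theorem rising_add (x : ℝ) (m n : ℕ) : rising x (m + n) = rising x m * rising (x + m) n := by
  simp [rising, ← ascPochhammer_mul]

theorem rising_pos {x : ℝ} {n : ℕ} (h : 0 < n → 0 < x) : 0 < rising x n := by
  rcases n.eq_zero_or_pos with rfl | hn
  · simp [rising]
  · exact ascPochhammer_pos n x (h hn)

/-- The rising factorial is read from its largest factor downwards, which is the order of the
factors in Aomoto's product. -/
theorem rising_sub_eq_prod (d : ℝ) (n : ℕ) :
    rising (d - n) n = ∏ j ∈ Finset.Icc 1 n, (d - j) := by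
  induction n with
  | zero => simp [rising]
  | succ n ih =>
    rw [Finset.prod_Icc_succ_top (by omega), ← ih, rising_succ_left, mul_comm]
    congr 2
    push_cast
    ring

theorem choose_eq_rising_div (N : ℕ) (s : ℝ) :
    Ring.choose (2 * N + s) N = rising (N + s + 1) N / N.factorial := by
  have h := Ring.factorial_nsmul_multichoose_eq_ascPochhammer ((N : ℝ) + s + 1) N
  rw [Ring.multichoose_eq, Polynomial.ascPochhammer_smeval_eq_eval, nsmul_eq_mul] at h
  rw [show 2 * (N : ℝ) + s = N + s + 1 + N - 1 by ring, rising, ← h]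
  field_simp

/-! ### Coefficients of the Jacobi polynomial -/

section Jacobi

variable {N : ℕ} {α β : ℝ}

/-- For `N ≥ 1` the base exceeds `N - 1 ≥ 0`. For `N = 0` the base may be negative, but then `k = 0`
and the product is empty. -/
theorem rising_jacobi_pos (hα : -1 < α) (hβ : -1 < β) (k : ℕ) (hk : k ≤ N) :
    0 < rising (N + α + β + 1) k :=
  rising_pos fun h => by
    have : (1 : ℝ) ≤ N := by exact_mod_cast h.trans_le hk
    linarith

theorem jacobiP_coeff (n k : ℕ) (α β : ℝ) :
    (jacobiP n α β).coeff k = ∑ l ∈ Finset.range (n + 1),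
      ((n.choose l : ℝ) * (rising (n + α + β + 1) l * rising (α + l + 1) (n - l)) /
        (n.factorial : ℝ)) * ((1 / 2) ^ l * ((-1) ^ (l - k) * (l.choose k : ℝ))) := by
  rw [jacobiP, Polynomial.finsetSum_coeff]
  refine Finset.sum_congr rfl fun l _ => ?_
  rw [Polynomial.coeff_C_mul, mul_pow, ← Polynomial.C_pow, Polynomial.coeff_C_mul,
    show (Polynomial.X - 1 : Polynomial ℝ) = Polynomial.X + Polynomial.C (-1) by
      simp [sub_eq_add_neg], Polynomial.coeff_X_add_C_pow]

theorem jacobiP_leadingCoeff (hα : -1 < α) (hβ : -1 < β) :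
    (jacobiP N α β).leadingCoeff = rising (N + α + β + 1) N / (N.factorial * 2 ^ N) := by
  have hN : (jacobiP N α β).coeff N = rising (N + α + β + 1) N / (N.factorial * 2 ^ N) := by
    rw [jacobiP_coeff, Finset.sum_range_succ, Finset.sum_eq_zero fun l hl => ?_]
    · simp [rising]
      field_simp
    · rw [Nat.choose_eq_zero_of_lt (Finset.mem_range.1 hl)]
      simp
  have hle : (jacobiP N α β).natDegree ≤ N := by
    rw [Polynomial.natDegree_le_iff_coeff_eq_zero]
    intro m hm
    rw [jacobiP_coeff]
    refine Finset.sum_eq_zero fun l hl => ?_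
    have hlm : l < m := (Nat.lt_succ_iff.1 (Finset.mem_range.1 hl)).trans_lt hm
    rw [Nat.choose_eq_zero_of_lt hlm]
    simp
  have hne : (jacobiP N α β).coeff N ≠ 0 := by
    rw [hN]
    exact (div_pos (rising_jacobi_pos hα hβ N le_rfl) (by positivity)).ne'
  rw [Polynomial.leadingCoeff, hle.antisymm (Polynomial.le_natDegree_of_ne_zero hne), hN]

theorem jacobiP_leadingCoeff_inv (hα : -1 < α) (hβ : -1 < β) :
    1 / (jacobiP N α β).leadingCoeff = 2 ^ N / Ring.choose (2 * N + α + β) N := by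
  rw [jacobiP_leadingCoeff hα hβ, add_assoc (2 * (N : ℝ)), choose_eq_rising_div, ← add_assoc]
  field_simp

/-- The Aomoto product in terms of rising factorials. -/
theorem aomoto_prod_eq {a b γ : ℝ} (hα : -1 < α) (hβ : -1 < β) (hγ : 0 < γ)
    (ha : a = γ * (α + 1)) (hb : b = γ * (β + 1)) {n k : ℕ} (hn : n + k = N) :
    ∏ j ∈ Finset.Icc 1 n, (a + ((N : ℝ) - j) * γ) / (a + b + (2 * (N : ℝ) - j - 1) * γ) =
      rising (N + α + β + 1) k * rising (α + k + 1) n / rising (N + α + β + 1) N := by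
  have hk : (k : ℝ) = N - n := by rw [← hn]; push_cast; ring
  -- Cancelling the `k` lowest factors of the length-`N` rising factorial leaves the `n` highest,
  -- which are Aomoto's denominators divided by `γ`.
  have h1 : rising (N + α + β + 1) N = rising (N + α + β + 1) k *
      ∏ j ∈ Finset.Icc 1 n, (2 * N + α + β + 1 - (j : ℝ)) := by
    rw [← rising_sub_eq_prod, show rising (N + α + β + 1) N = rising (N + α + β + 1) (k + n) by
      rw [add_comm k, hn], rising_add, hk]
    congr 2
    ring
  have h2 : rising (α + k + 1) n = ∏ j ∈ Finset.Icc 1 n, (N + α + 1 - (j : ℝ)) := by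
    rw [← rising_sub_eq_prod, hk]
    congr 1
    ring
  have hp := rising_jacobi_pos (N := N) hα hβ k (by omega)
  rw [h1, h2, mul_div_mul_left _ _ hp.ne', ← Finset.prod_div_distrib]
  refine Finset.prod_congr rfl fun j _ => ?_
  rw [show a + ((N : ℝ) - j) * γ = γ * (N + α + 1 - j) by rw [ha]; ring,
    show a + b + (2 * (N : ℝ) - j - 1) * γ = γ * (2 * N + α + β + 1 - j) by rw [ha, hb]; ring,
    mul_div_mul_left _ _ hγ.ne']

/-- The two sums agree term by term under `k = N - n`; the monic normalization supplies `2 ^ N` and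
the denominator. -/
theorem sum_aomoto_eq_jacobiP {a b γ : ℝ} (hα : -1 < α) (hβ : -1 < β) (hγ : 0 < γ)
    (ha : a = γ * (α + 1)) (hb : b = γ * (β + 1)) (y : ℝ) :
    ∑ n ∈ Finset.range (N + 1), 2 ^ n * (y - 1) ^ (N - n) * ((N.choose n : ℝ) *
      ∏ j ∈ Finset.Icc 1 n, (a + ((N : ℝ) - j) * γ) / (a + b + (2 * (N : ℝ) - j - 1) * γ)) =
      1 / (jacobiP N α β).leadingCoeff * (jacobiP N α β).eval y := by
  rw [jacobiP_leadingCoeff hα hβ, jacobiP, Polynomial.eval_finsetSum,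
    ← Finset.sum_range_reflect, Finset.mul_sum]
  refine Finset.sum_congr rfl fun k hk => ?_
  have hk : k ≤ N := by have := Finset.mem_range.1 hk; omega
  rw [show N + 1 - 1 - k = N - k by omega, Nat.sub_sub_self hk, Nat.choose_symm hk,
    aomoto_prod_eq hα hβ hγ ha hb (Nat.sub_add_cancel hk)]
  have hp := rising_jacobi_pos (N := N) hα hβ N le_rfl
  have h2 : (2 : ℝ) ^ N = 2 ^ (N - k) * 2 ^ k := by rw [← pow_add, Nat.sub_add_cancel hk]
  simp only [Polynomial.eval_mul, Polynomial.eval_C, Polynomial.eval_pow, Polynomial.eval_sub,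
    Polynomial.eval_X, Polynomial.eval_one, mul_pow, h2, one_div, inv_pow]
  field_simp

end Jacobi

/-! ### Expectations under the Jacobi ensemble -/

section Law

variable {N : ℕ} {k₁ k₂ k₃ : ℝ}

/-- Expectations of symmetric functions of the Jacobi ensemble are quotients of Selberg integrals. -/
theorem expectation_eq (hk₃ : 0 < k₃) (hk₂ : -1 / 2 < k₂) (hk₁₂ : -1 / 2 < k₁ + k₂)
    {Ω : Type*} [MeasurableSpace Ω] {P : Measure Ω} [IsProbabilityMeasure P]
    {X : Ω → Fin N → ℝ} {c : ℝ} (hX : AEMeasurable X P)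
    (hlaw : P.map X = (volume.restrict (alcove N)).withDensity
      fun x => ENNReal.ofReal (c * weight N k₁ k₂ k₃ x))
    {f : (Fin N → ℝ) → ℝ} (hf : Continuous f)
    (hsym : ∀ x (σ : Equiv.Perm (Fin N)), f (x ∘ σ) = f x) :
    Integrable (fun ω => f (X ω)) P ∧ ∫ ω, f (X ω) ∂P =
      (∫ u in Set.Icc (0 : Fin N → ℝ) 1, f (1 - (2 : ℝ) • u) *
          selbergWeight N (k₁ + k₂ + 1 / 2) (k₂ + 1 / 2) k₃ u) /
        ∫ u in Set.Icc (0 : Fin N → ℝ) 1,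
          selbergWeight N (k₁ + k₂ + 1 / 2) (k₂ + 1 / 2) k₃ u := by
  have hprob : IsProbabilityMeasure (P.map X) := Measure.isProbabilityMeasure_map hX
  have hAm : MeasurableSet (alcove N) := by
    rw [alcove_eq]
    exact isClosed_monotone.measurableSet.inter measurableSet_Icc
  have hw0 : ∀ x ∈ alcove N, 0 ≤ weight N k₁ k₂ k₃ x := fun x hx =>
    mul_nonneg (Finset.prod_nonneg fun i _ => mul_nonneg
      (Real.rpow_nonneg (sub_nonneg.2 (hx.1 i).2) _)
      (Real.rpow_nonneg (by linarith [(hx.1 i).1]) _)) (interaction_nonneg _ _ _)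
  have hwm : Measurable (weight N k₁ k₂ k₃) := by
    unfold weight interaction
    fun_prop
  have hdm : Measurable fun x => ENNReal.ofReal (c * weight N k₁ k₂ k₃ x) :=
    (hwm.const_mul c).ennreal_ofReal
  -- The sign of `c` is not assumed: for `c < 0`, `ENNReal.ofReal` would truncate the density to
  -- zero, which is not a probability law.
  have hc : 0 ≤ c := by
    by_contra hc
    have h0 : P.map X Set.univ = 0 := by
      rw [hlaw, withDensity_apply _ MeasurableSet.univ, Measure.restrict_univ,
        setLIntegral_congr_fun (g := fun _ => 0) hAm fun x hx => ?_]
      · simp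
      · exact ENNReal.ofReal_of_nonpos
          (mul_nonpos_of_nonpos_of_nonneg (not_le.1 hc).le (hw0 x hx))
    simp [hprob.measure_univ] at h0
  have hE : ∀ g : (Fin N → ℝ) → ℝ, Continuous g →
      ∫ ω, g (X ω) ∂P = c * ∫ x in alcove N, g x * weight N k₁ k₂ k₃ x := fun g hg => by
    rw [← integral_map hX hg.aestronglyMeasurable, hlaw,
      integral_withDensity_eq_integral_toReal_smul hdm (by simp), ← integral_const_mul]
    refine setIntegral_congr_fun hAm fun x hx => ?_
    simp only [ENNReal.toReal_ofReal (mul_nonneg hc (hw0 x hx)), smul_eq_mul]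
    ring
  obtain ⟨K, hK, hKf⟩ := exists_integral_alcove_eq N hk₃ hk₂ hk₁₂
  constructor
  · obtain ⟨C, hC⟩ := (isCompact_Icc (a := (-1 : Fin N → ℝ)) (b := 1)).exists_bound_of_continuousOn
      hf.continuousOn
    have hae : ∀ᵐ x ∂(P.map X), x ∈ alcove N := by
      rw [hlaw]
      exact (withDensity_absolutelyContinuous _ _).ae_le (ae_restrict_mem hAm)
    have hi : Integrable f (P.map X) := by
      refine Integrable.of_bound hf.aestronglyMeasurable C ?_
      filter_upwards [hae] with x hx
      rw [alcove_eq] at hx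
      exact hC x hx.2
    exact hi.comp_aemeasurable hX
  -- The constant function gives `c * K` times Selberg's integral equal to one. This eliminates `c`
  -- and `K` and shows that the integral is nonzero.
  · have h1 := hE (fun _ => 1) continuous_const
    rw [hKf _ continuous_const fun _ _ => rfl] at h1
    simp only [integral_const, probReal_univ, smul_eq_mul, one_mul, mul_one] at h1
    rw [hE f hf, hKf f hf hsym, eq_div_iff]
    · linear_combination (-∫ u in Set.Icc (0 : Fin N → ℝ) 1, f (1 - (2 : ℝ) • u) *
          selbergWeight N (k₁ + k₂ + 1 / 2) (k₂ + 1 / 2) k₃ u) * h1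
    · rintro h
      rw [h] at h1
      simp at h1


/-- The expected characteristic polynomial of the Jacobi ensemble is the monic Jacobi
polynomial. -/
theorem expectation_prod_sub {α β : ℝ}
    (hk₃ : 0 < k₃) (hk₂ : -1 / 2 < k₂) (hk₁₂ : -1 / 2 < k₁ + k₂)
    (hα : -1 < α) (hβ : -1 < β) (ha : k₁ + k₂ + 1 / 2 = k₃ * (α + 1))
    (hb : k₂ + 1 / 2 = k₃ * (β + 1))
    {Ω : Type*} [MeasurableSpace Ω] {P : Measure Ω} [IsProbabilityMeasure P]
    {X : Ω → Fin N → ℝ} {c : ℝ} (hX : AEMeasurable X P)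
    (hlaw : P.map X = (volume.restrict (alcove N)).withDensity
      fun x => ENNReal.ofReal (c * weight N k₁ k₂ k₃ x)) (y : ℝ) :
    Integrable (fun ω => ∏ i, (y - X ω i)) P ∧ ∫ ω, ∏ i, (y - X ω i) ∂P =
      1 / (jacobiP N α β).leadingCoeff * (jacobiP N α β).eval y := by
  have ha0 : 0 < k₁ + k₂ + 1 / 2 := by linarith
  have hb0 : 0 < k₂ + 1 / 2 := by linarith
  have h := expectation_eq hk₃ hk₂ hk₁₂ hX hlaw (f := fun x => ∏ i, (y - x i)) (by fun_prop)
    fun x σ => Equiv.prod_comp σ fun i => y - x i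
  refine ⟨h.1, h.2.trans ?_⟩
  have hexp : ∀ u : Fin N → ℝ, ∏ i, (y - (1 - (2 : ℝ) • u) i) =
      ∑ n ∈ Finset.range (N + 1), 2 ^ n * (y - 1) ^ (N - n) * e N n u := fun u => by
    rw [Finset.sum_congr rfl fun n _ => show _ = e N n (fun i => 2 * u i) * (y - 1) ^ (N - n) by
      rw [e_const_mul]; ring, ← prod_add_eq_sum_e]
    refine Finset.prod_congr rfl fun i _ => ?_
    simp only [Pi.sub_apply, Pi.one_apply, Pi.smul_apply, smul_eq_mul]
    ring
  have hpos := integral_selbergWeight_pos (N := N) ha0 hb0 hk₃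
  simp only [hexp, Finset.sum_mul, mul_assoc ((2 : ℝ) ^ _ * _)]
  rw [integral_finsetSum _ fun n _ => (integrableOn_mul_selbergWeight ha0 hb0 hk₃
    (continuous_e N n)).const_mul _, ← sum_aomoto_eq_jacobiP hα hβ hk₃ ha hb y, div_eq_iff hpos.ne',
    Finset.sum_mul]
  refine Finset.sum_congr rfl fun n _ => ?_
  rw [integral_const_mul, integral_e_mul_selbergWeight ha0 hb0 hk₃]
  ring

/-- The expected elementary symmetric polynomials are coefficients of a Jacobi polynomial. -/
theorem expectation_e {α β : ℝ}
    (hk₃ : 0 < k₃) (hk₂ : -1 / 2 < k₂) (hk₁₂ : -1 / 2 < k₁ + k₂)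
    (hα : -1 < α) (hβ : -1 < β) (ha : k₁ + k₂ + 1 / 2 = k₃ * (α + 1))
    (hb : k₂ + 1 / 2 = k₃ * (β + 1))
    {Ω : Type*} [MeasurableSpace Ω] {P : Measure Ω} [IsProbabilityMeasure P]
    {X : Ω → Fin N → ℝ} {c : ℝ} (hX : AEMeasurable X P)
    (hlaw : P.map X = (volume.restrict (alcove N)).withDensity
      fun x => ENNReal.ofReal (c * weight N k₁ k₂ k₃ x)) {n : ℕ} (hn : n ≤ N) :
    Integrable (fun ω => e N n (X ω)) P ∧ ∫ ω, e N n (X ω) ∂P =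
      1 / (jacobiP N α β).leadingCoeff * ((-1) ^ n * (jacobiP N α β).coeff (N - n)) := by
  have hint : ∀ m, Integrable (fun ω => e N m (X ω)) P := fun m =>
    (expectation_eq hk₃ hk₂ hk₁₂ hX hlaw (continuous_e N m) fun x σ => e_comp_perm m x σ).1
  refine ⟨hint n, ?_⟩
  -- Equality at every real `y` is an equality of polynomials, so coefficients can be compared.
  have hpoly : ∑ m ∈ Finset.range (N + 1),
      Polynomial.C ((-1) ^ m * ∫ ω, e N m (X ω) ∂P) * Polynomial.X ^ (N - m) =
      Polynomial.C (1 / (jacobiP N α β).leadingCoeff) * jacobiP N α β := by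
    refine Polynomial.funext fun y => ?_
    rw [Polynomial.eval_mul, Polynomial.eval_C,
      ← (expectation_prod_sub hk₃ hk₂ hk₁₂ hα hβ ha hb hX hlaw y).2, Polynomial.eval_finsetSum]
    have hexp : ∀ x : Fin N → ℝ, ∏ i, (y - x i) =
        ∑ m ∈ Finset.range (N + 1), (-1) ^ m * y ^ (N - m) * e N m x := fun x => by
      rw [Finset.sum_congr rfl fun m _ => show _ = e N m (fun i => -1 * x i) * y ^ (N - m) by
        rw [e_const_mul]; ring, ← prod_add_eq_sum_e]
      exact Finset.prod_congr rfl fun i _ => by ring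
    simp only [hexp]
    rw [integral_finsetSum _ fun m _ => (hint m).const_mul _]
    refine Finset.sum_congr rfl fun m _ => ?_
    rw [integral_const_mul]
    simp only [Polynomial.eval_mul, Polynomial.eval_C, Polynomial.eval_pow, Polynomial.eval_X]
    ring
  have hcoeff := congrArg (fun p => p.coeff (N - n)) hpoly
  simp only [Polynomial.finsetSum_coeff, Polynomial.coeff_C_mul, Polynomial.coeff_X_pow] at hcoeff
  rw [Finset.sum_eq_single n] at hcoeff
  · rw [if_pos rfl, mul_one] at hcoeff
    rw [mul_left_comm, ← hcoeff, ← mul_assoc, ← mul_pow]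
    simp
  · intro m hm hmn
    have := Finset.mem_range.1 hm
    rw [if_neg (by omega), mul_zero]
  · intro h
    exact absurd (Finset.mem_range.2 (by omega)) h

end Law

end JacobiEnsemble

/-! ### The main theorem -/

theorem mainTheorem2 (N : ℕ) (k₁ k₂ k₃ : ℝ)
    (hk₃ : 0 < k₃) (hk₂ : -1 / 2 < k₂) (hk₁₂ : -1 / 2 < k₁ + k₂)
    (α β : ℝ) (hα : α = (1 + 2 * k₁ + 2 * k₂) / (2 * k₃) - 1)
    (hβ : β = (1 + 2 * k₂) / (2 * k₃) - 1) :
    -- the parameters are admissible, and the weight can be normalized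
    (-1 < α ∧ -1 < β) ∧
    (IntegrableOn (JacobiEnsemble.weight N k₁ k₂ k₃) (JacobiEnsemble.alcove N) ∧
      0 < ∫ x in JacobiEnsemble.alcove N, JacobiEnsemble.weight N k₁ k₂ k₃ x) ∧
    -- every random variable with the normalized density
    (∀ (Ω : Type*) [MeasurableSpace Ω] (P : Measure Ω) [IsProbabilityMeasure P]
        (X : Ω → Fin N → ℝ) (c : ℝ), AEMeasurable X P →
        P.map X = (volume.restrict (JacobiEnsemble.alcove N)).withDensity
          (fun x => ENNReal.ofReal (c * JacobiEnsemble.weight N k₁ k₂ k₃ x)) →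
      (∀ y : ℝ, Integrable (fun ω => ∏ i, (y - X ω i)) P ∧
        ∫ ω, ∏ i, (y - X ω i) ∂P =
          1 / (JacobiEnsemble.jacobiP N α β).leadingCoeff *
            (JacobiEnsemble.jacobiP N α β).eval y) ∧
      (∀ n : ℕ, n ≤ N → Integrable (fun ω => JacobiEnsemble.e N n (X ω)) P ∧
        ∫ ω, JacobiEnsemble.e N n (X ω) ∂P =
          2 ^ N / Ring.choose (2 * N + α + β) N *
            ∑ l ∈ Finset.Icc (N - n) N,
              (-1) ^ (N - l) * (N.choose l : ℝ) * (l.choose (N - n) : ℝ) *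
                (JacobiEnsemble.rising (N + α + β + 1) l *
                    JacobiEnsemble.rising (α + l + 1) (N - l) /
                  ((N.factorial : ℝ) * 2 ^ l)))) ∧
    -- Aomoto's form of Selberg's integral
    (∀ n : ℕ, n ≤ N → ∀ a b : ℝ, a = k₁ + k₂ + 1 / 2 → b = k₂ + 1 / 2 →
      (∫ u in Set.Icc (0 : Fin N → ℝ) 1,
          JacobiEnsemble.e N n u * JacobiEnsemble.selbergWeight N a b k₃ u) /
        (∫ u in Set.Icc (0 : Fin N → ℝ) 1, JacobiEnsemble.selbergWeight N a b k₃ u) =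
      (N.choose n : ℝ) * ∏ j ∈ Finset.Icc 1 n,
        (a + ((N : ℝ) - j) * k₃) / (a + b + (2 * (N : ℝ) - j - 1) * k₃)) := by
  have ha0 : 0 < k₁ + k₂ + 1 / 2 := by linarith
  have hb0 : 0 < k₂ + 1 / 2 := by linarith
  have ha : k₁ + k₂ + 1 / 2 = k₃ * (α + 1) := by
    rw [hα]
    field_simp
    ring
  have hb : k₂ + 1 / 2 = k₃ * (β + 1) := by
    rw [hβ]
    field_simp
    ring
  have hα1 : -1 < α := by linarith [pos_of_mul_pos_right (ha ▸ ha0) hk₃.le]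
  have hβ1 : -1 < β := by linarith [pos_of_mul_pos_right (hb ▸ hb0) hk₃.le]
  refine ⟨⟨hα1, hβ1⟩, ⟨?_, ?_⟩, ?_, ?_⟩
  · simpa using JacobiEnsemble.integrableOn_alcove_mul_weight N hk₃ hk₂ hk₁₂
      (continuous_const (y := (1 : ℝ)))
  · obtain ⟨K, hK, h⟩ := JacobiEnsemble.exists_integral_alcove_eq N hk₃ hk₂ hk₁₂
    have h1 := h (fun _ => 1) continuous_const fun _ _ => rfl
    simp only [one_mul] at h1
    rw [h1]
    exact mul_pos hK (JacobiEnsemble.integral_selbergWeight_pos ha0 hb0 hk₃)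
  · intro Ω _ P _ X c hX hlaw
    refine ⟨fun y => JacobiEnsemble.expectation_prod_sub hk₃ hk₂ hk₁₂ hα1 hβ1 ha hb hX hlaw y,
      fun n hn => ?_⟩
    obtain ⟨hint, he⟩ :=
      JacobiEnsemble.expectation_e hk₃ hk₂ hk₁₂ hα1 hβ1 ha hb hX hlaw hn
    refine ⟨hint, he.trans ?_⟩
    rw [JacobiEnsemble.jacobiP_leadingCoeff_inv hα1 hβ1, JacobiEnsemble.jacobiP_coeff,
      Finset.mul_sum]
    congr 1
    -- The terms with `l < N - n` drop out because `l.choose (N - n)` vanishes.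
    rw [← Finset.sum_subset (s₁ := Finset.Icc (N - n) N)]
    · refine Finset.sum_congr rfl fun l hl => ?_
      obtain ⟨hl1, hl2⟩ := Finset.mem_Icc.1 hl
      have hsign : (-1 : ℝ) ^ n * (-1) ^ (l - (N - n)) = (-1) ^ (N - l) := by
        rw [← pow_add, show n + (l - (N - n)) = N - l + 2 * (l - (N - n)) by omega, pow_add,
          pow_mul]
        simp
      rw [← hsign, one_div, inv_pow]
      field_simp
    · intro l hl
      have := (Finset.mem_Icc.1 hl).2
      exact Finset.mem_range.2 (by omega)
    · intro l hl hl'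
      have hlt : l < N - n := by
        by_contra h
        exact hl' (Finset.mem_Icc.2 ⟨not_lt.1 h, Nat.lt_succ_iff.1 (Finset.mem_range.1 hl)⟩)
      rw [Nat.choose_eq_zero_of_lt hlt]
      simp
  · rintro n - a b rfl rfl
    rw [JacobiEnsemble.integral_e_mul_selbergWeight ha0 hb0 hk₃,
      mul_div_cancel_right₀ _ (JacobiEnsemble.integral_selbergWeight_pos ha0 hb0 hk₃).ne']
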